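/- Let $\mathcal D$ be a dyadic grid on $\mathbb R^n$: a collection of half-open cubes $\prod_i[a_i,a_i+2^k)$, $k\in\mathbb Z$, such that for every $k\in\mathbb Z$ the cubes of side length $2^k$ in $\mathcal D$ partition $\mathbb R^n$, and $P\cap Q\in\{P,Q,\emptyset\}$ for all $P,Q\in\mathcal D$. For $Q_0\in\mathcal D$ put $\mathcal D(Q_0)=\{Q\in\mathcal D: Q\subset Q_0\}$, and let $\langle g\rangle_Q=\frac1{|Q|}\int_Q g\,dx$, $(g,h)=\int gh\,dx$. For an interval $I$ let $h_I^0=|I|^{-1/2}(1_{I_+}-1_{I_-})$ ($I_+,I_-$ the right and left halves) and $h_I^1=|I|^{-1/2}1_I$; for a cube $Q=I_1\times\dots\times I_n$ and a signature $\epsilon\in\{0,1\}^n$ let $h_Q^\epsilon(x)=\prod_k h_{I_k}^{\epsilon_k}(x_k)$, which is cancellative if $\epsilon\not\equiv1$; for two signatures let $\epsilon+\eta$ be the signature with $h_Q^\epsilon h_Q^\eta=|Q|^{-1/2}h_Q^{\epsilon+\eta}$. A weight is a locally integrable, a.e. positive function $w$ on $\mathbb R^n$, $w(Q)=\int_Q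 w\,dx$, and $BMO^{\mathcal D}(w)$ is the space of locally integrable real functions $b$ with $\|b\|_{BMO^{\mathcal D}(w)}=\sup_{Q\in\mathcal D}\frac1{w(Q)}\int_Q|b-\langle b\rangle_Q|\,dx<\infty$. Consider the restricted paraproducts $$\Pi_{b,Q_0}f=\sum_{Q\in\mathcal D(Q_0)}\sum_{\epsilon\not\equiv1}(b,h_Q^\epsilon)\langle f\rangle_Q h_Q^\epsilon,\qquad \Pi^*_{b,Q_0}f=\sum_{Q\in\mathcal D(Q_0)}\sum_{\epsilon\not\equiv1}(b,h_Q^\epsilon)(f,h_Q^\epsilon)\frac{1_Q}{|Q|},$$ $$\Gamma_{b,Q_0}f=\sum_{Q\in\mathcal D(Q_0)}\ \sum_{\epsilon,\eta\not\equiv1,\ \epsilon\ne\eta}(b,h_Q^\epsilon)(f,h_Q^\eta)\,|Q|^{-1/2}\,h_Q^{\epsilon+\eta},$$ the series being summed pointwise in the order of decreasing side length of $Q$. A collection $\mathcal S\subset\mathcal D$ is $\Lambda$-Carleson if $\sum_{P\in\mathcal S,P\subset Q}|P|\le\Lambda|Q|$ for all $Q\in\mathcal D$, and $\eta$-sparse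 if there are pairwise disjoint measurable sets $E_Q\subset Q$, $Q\in\mathcal S$, with $|E_Q|\ge\eta|Q|$. Let $\mathcal A^w_{\mathcal S}|f|=\sum_{Q\in\mathcal S}\langle w\rangle_Q\langle|f|\rangle_Q1_Q$, with values in $[0,\infty]$. Theorem. There is a constant $C(n)>0$ depending only on $n$ such that for every dyadic grid $\mathcal D$ on $\mathbb R^n$, every $\Lambda>1$, every weight $w$ on $\mathbb R^n$, every $b\in BMO^{\mathcal D}(w)$, $Q_0\in\mathcal D$ and $f\in L^1(Q_0)$ (all functions real-valued), there is a $\Lambda$-Carleson, $\frac1\Lambda$-sparse collection $\mathcal S(Q_0)\subset\mathcal D(Q_0)$ (depending on $b,w,f$) such that the series $\Pi_{b,Q_0}f(x)$ converges for almost every $x\in Q_0$ and $$|\Pi_{b,Q_0}f(x)|\le C(n)\Big(\frac{\Lambda}{\Lambda-1}\Big)^2\|b\|_{BMO^{\mathcal D}(w)}\,\mathcal A^w_{\mathcal S(Q_0)}|f|(x)\qquad\text{for all }x\in Q_0,$$ where at each $x\in Q_0$ the bound holds for the sum of the series, if it converges there, and also for each of its truncations to the cubes $Q$ of side length at least $2^m$,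 $m\in\mathbb Z$. The same holds for $\Pi^*_{b,Q_0}f$ and for $\Gamma_{b,Q_0}f$, each with its own collection $\mathcal S(Q_0)$. -/

import Mathlib

open MeasureTheory Filter Topology Set
open scoped ENNReal

noncomputable section

/-- A half-open cube `∏ i, [corner i, corner i + 2 ^ scale)` of side length `2 ^ scale` in `ℝⁿ`. -/
structure DyadicCube (n : ℕ) where
  corner : Fin n → ℝ
  scale : ℤ

namespace DyadicCube

variable {n : ℕ}

/-- The side length of a cube. -/
def side (Q : DyadicCube n) : ℝ := (2 : ℝ) ^ Q.scale

/-- The cube as a subset of `ℝⁿ`. -/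
def carrier (Q : DyadicCube n) : Set (Fin n → ℝ) :=
  {x | ∀ i, x i ∈ Ico (Q.corner i) (Q.corner i + Q.side)}

/-- The Lebesgue measure of a cube, as a real number. -/
def vol (Q : DyadicCube n) : ℝ := volume.real Q.carrier

end DyadicCube

/-- A dyadic grid on `ℝⁿ`: a collection of cubes with side lengths `2 ^ k`, `k ∈ ℤ`, such that for
every `k` the cubes of side length `2 ^ k` partition `ℝⁿ`, and such that the intersection of
any two of the cubes `P`, `Q` is `P`, `Q` or empty. -/
structure DyadicGrid (n : ℕ) where
  cubes : Set (DyadicCube n)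
  partition : ∀ (k : ℤ) (x : Fin n → ℝ), ∃! Q, Q ∈ cubes ∧ Q.scale = k ∧ x ∈ Q.carrier
  nested : ∀ P ∈ cubes, ∀ Q ∈ cubes, P.carrier ∩ Q.carrier = P.carrier ∨
    P.carrier ∩ Q.carrier = Q.carrier ∨ P.carrier ∩ Q.carrier = ∅

/-- The cubes of the grid that are contained in `Q₀`. -/
def DyadicGrid.subcubes {n : ℕ} (D : DyadicGrid n) (Q₀ : DyadicCube n) : Set (DyadicCube n) :=
  {Q | Q ∈ D.cubes ∧ Q.carrier ⊆ Q₀.carrier}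

/-! ### Haar functions -/

/-- The one-dimensional Haar functions of the interval `I = [a, a + l)`: for the signature `false`
the cancellative `|I|^(-1/2) (1_{I₊} - 1_{I₋})`, with `I₊`, `I₋` the right and left halves, and for
the signature `true` the non-cancellative `|I|^(-1/2) 1_I`. -/
def haarOne (a l : ℝ) : Bool → ℝ → ℝ
  | false, t => (√l)⁻¹ * ((Ico (a + l / 2) (a + l)).indicator 1 t - (Ico a (a + l / 2)).indicator 1 t)
  | true, t => (√l)⁻¹ * (Ico a (a + l)).indicator 1 t

/-- The Haar function of the cube `Q` with signature `ε`. -/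
def haar {n : ℕ} (Q : DyadicCube n) (ε : Fin n → Bool) (x : Fin n → ℝ) : ℝ :=
  ∏ i, haarOne (Q.corner i) Q.side (ε i) (x i)

/-- The signatures of the cancellative Haar functions: all but the constant signature `true`. -/
def cancellative (n : ℕ) : Finset (Fin n → Bool) := Finset.univ.filter (fun ε => ε ≠ fun _ => true)

/-- The signature of a product of two Haar functions of one cube:
`haar Q ε * haar Q η = |Q|^(-1/2) * haar Q (signatureAdd ε η)`. -/
def signatureAdd {n : ℕ} (ε η : Fin n → Bool) : Fin n → Bool := fun i => ε i == η i

/-- The Haar coefficient `(g, h_Q^ε) = ∫ g h_Q^ε dx`. -/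
def haarCoeff {n : ℕ} (g : (Fin n → ℝ) → ℝ) (Q : DyadicCube n) (ε : Fin n → Bool) : ℝ :=
  ∫ x, g x * haar Q ε x

/-- The average of `g` over the cube `Q` with respect to Lebesgue measure. -/
def cubeAvg {n : ℕ} (g : (Fin n → ℝ) → ℝ) (Q : DyadicCube n) : ℝ := ⨍ x in Q.carrier, g x

/-! ### Weights and weighted dyadic BMO -/

/-- A weight: a locally integrable, almost everywhere positive function on `ℝⁿ`. -/
def IsWeight {n : ℕ} (w : (Fin n → ℝ) → ℝ) : Prop :=
  LocallyIntegrable w volume ∧ ∀ᵐ x, 0 < w x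

/-- `sup_{Q ∈ D} (1 / w(Q)) ∫_Q |b - ⟨b⟩_Q| dx`. -/
def bmoNorm {n : ℕ} (D : DyadicGrid n) (w b : (Fin n → ℝ) → ℝ) : ℝ≥0∞ :=
  ⨆ Q ∈ D.cubes, (∫⁻ x in Q.carrier, ‖b x - cubeAvg b Q‖ₑ) /
    ∫⁻ x in Q.carrier, ENNReal.ofReal (w x)

/-- Membership in the dyadic weighted BMO space. -/
def MemBMO {n : ℕ} (D : DyadicGrid n) (w b : (Fin n → ℝ) → ℝ) : Prop :=
  LocallyIntegrable b volume ∧ bmoNorm D w b < ∞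

/-! ### Paraproducts -/

/-- The term of the cube `Q` in the paraproduct `Π_b f`. -/
def paraTerm {n : ℕ} (b f : (Fin n → ℝ) → ℝ) (Q : DyadicCube n) (x : Fin n → ℝ) : ℝ :=
  ∑ ε ∈ cancellative n, haarCoeff b Q ε * cubeAvg f Q * haar Q ε x

/-- The term of the cube `Q` in the paraproduct `Π_b^* f`. -/
def paraAdjTerm {n : ℕ} (b f : (Fin n → ℝ) → ℝ) (Q : DyadicCube n) (x : Fin n → ℝ) : ℝ :=
  ∑ ε ∈ cancellative n, haarCoeff b Q ε * haarCoeff f Q ε * (Q.carrier.indicator 1 x / Q.vol)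

/-- The term of the cube `Q` in the paraproduct `Γ_b f`. -/
def gammaTerm {n : ℕ} (b f : (Fin n → ℝ) → ℝ) (Q : DyadicCube n) (x : Fin n → ℝ) : ℝ :=
  ∑ ε ∈ cancellative n, ∑ η ∈ (cancellative n).filter (fun η => ε ≠ η),
    haarCoeff b Q ε * haarCoeff f Q η * ((√Q.vol)⁻¹ * haar Q (signatureAdd ε η) x)

/-- The sum at the point `x` of the terms `T Q x` over the cubes `Q ∈ D(Q₀)` of side length at
least `2 ^ m`. (If `T Q` vanishes off `Q`, only finitely many terms are nonzero.) -/
def truncatedSum {n : ℕ} (D : DyadicGrid n) (Q₀ : DyadicCube n)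
    (T : DyadicCube n → (Fin n → ℝ) → ℝ) (m : ℤ) (x : Fin n → ℝ) : ℝ :=
  ∑ᶠ (Q : DyadicCube n) (_ : Q ∈ D.subcubes Q₀ ∧ m ≤ Q.scale), T Q x

/-- The series `∑_{Q ∈ D(Q₀)} T Q x`, summed in the order of decreasing side length, converges
to `s`. -/
def SumsTo {n : ℕ} (D : DyadicGrid n) (Q₀ : DyadicCube n)
    (T : DyadicCube n → (Fin n → ℝ) → ℝ) (x : Fin n → ℝ) (s : ℝ) : Prop :=
  Tendsto (fun m : ℤ => truncatedSum D Q₀ T m x) atBot (𝓝 s)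

/-! ### Sparse collections and sparse operators -/

/-- `S` is `Λ`-Carleson: `∑_{P ∈ S, P ⊆ Q} |P| ≤ Λ |Q|` for all `Q ∈ D`. -/
def IsCarleson {n : ℕ} (D : DyadicGrid n) (Λ : ℝ) (S : Set (DyadicCube n)) : Prop :=
  ∀ Q ∈ D.cubes, ∑' P : {P : DyadicCube n // P ∈ S ∧ P.carrier ⊆ Q.carrier}, volume P.1.carrier ≤
    ENNReal.ofReal Λ * volume Q.carrier

/-- `S` is `η`-sparse: there are pairwise disjoint measurable `E_Q ⊆ Q`, `Q ∈ S`, with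
`|E_Q| ≥ η |Q|`. -/
def IsSparse {n : ℕ} (η : ℝ) (S : Set (DyadicCube n)) : Prop :=
  ∃ E : DyadicCube n → Set (Fin n → ℝ), S.PairwiseDisjoint E ∧
    ∀ Q ∈ S, MeasurableSet (E Q) ∧ E Q ⊆ Q.carrier ∧
      ENNReal.ofReal η * volume Q.carrier ≤ volume (E Q)

/-- The weighted sparse operator applied to `|f|`, at the point `x`:
`∑_{Q ∈ S} ⟨w⟩_Q ⟨|f|⟩_Q 1_Q(x)`, with values in `[0, ∞]`. -/
def sparseOp {n : ℕ} (w : (Fin n → ℝ) → ℝ) (S : Set (DyadicCube n)) (f : (Fin n → ℝ) → ℝ)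
    (x : Fin n → ℝ) : ℝ≥0∞ :=
  ∑' Q : S, Q.1.carrier.indicator (fun _ =>
    ENNReal.ofReal (cubeAvg w Q.1) * ENNReal.ofReal (cubeAvg (fun y => |f y|) Q.1)) x

/-- The operator given on `Q₀` by the series `∑_{Q ∈ D(Q₀)} T Q` is dominated on `Q₀` by `K` times
the sparse operator of a `Λ`-Carleson sparse collection of cubes in `D(Q₀)`: the series converges
almost everywhere in `Q₀`, and the bound holds at every point of `Q₀`, for the sum of the series
where it converges and for all its truncations. -/
def SparselyDominated {n : ℕ} (D : DyadicGrid n) (Q₀ : DyadicCube n) (Λ : ℝ) (K : ℝ≥0∞)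
    (w f : (Fin n → ℝ) → ℝ) (T : DyadicCube n → (Fin n → ℝ) → ℝ) : Prop :=
  ∃ S ⊆ D.subcubes Q₀, IsCarleson D Λ S ∧ IsSparse Λ⁻¹ S ∧
    (∀ᵐ x ∂(volume.restrict Q₀.carrier), ∃ s, SumsTo D Q₀ T x s) ∧
    (∀ x ∈ Q₀.carrier, ∀ s, SumsTo D Q₀ T x s → ‖s‖ₑ ≤ K * sparseOp w S f x) ∧
    (∀ x ∈ Q₀.carrier, ∀ m, ‖truncatedSum D Q₀ T m x‖ₑ ≤ K * sparseOp w S f x)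

end

/-!
The terms of the three series depend only on `f`, `b` and the cubes containing the point, so at a
fixed point the claim is about a sequence of terms indexed by the generations below `Q₀`. From a
cube `Q` the descent is stopped at the maximal cubes `R ⊊ Q` over which the average of `|f|` exceeds
`a ⟨|f|⟩_Q`, or that of `|b - ⟨b⟩_Q|` exceeds `a ‖b‖ ⟨w⟩_Q`, or the sum of the terms from `Q` down to
`R` exceeds a multiple of `a² ‖b‖ ⟨w⟩_Q ⟨|f|⟩_Q`; here `a = 3 Λ / (Λ - 1)`. The weight enters only
through the bound `‖b‖ ⟨w⟩_Q` for the mean oscillation of `b`. Each of the three reasons accounts for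
at most the fraction `1 / a` of `Q`, so the stopped cubes cover at most `1 - 1 / Λ` of `Q`
(`volume_stopCond_le`). Restarting from the stopped cubes produces the collection `principalCubes`,
which is sparse, hence Carleson, and over which the local bounds add up to the sparse operator
(`exists_sparse_domination`).

The first two fractions are weak type bounds for averages. The third one rests on an energy estimate,
`nodeSum_coeffEnergy_le`: the squares of the Haar coefficients over the cubes that are not stopped
have the sum that the bounded part of a Calderón–Zygmund decomposition allows, because `|R| ⟨g⟩_R²`
telescopes over the tree of these cubes. For `Π_b` the partial sums are martingales, whose `L²` norm
over the tree is bounded by this energy and the stopped averages of `f`. The terms of `Π_b^*` and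
`Γ_b` have the common nonnegative majorant `absTerm`, whose `L¹` norm over the tree is bounded by the
energies of `b` and `f`, by `2 x y ≤ θ x² + θ⁻¹ y²` with the right `θ`.

Almost every point lies in finitely many of the principal cubes, hence is not stopped below one of
them. There the majorants have bounded partial sums, and the martingale converges by the weak type
bound for its tails (`volume_tail_le`).

All sums over cubes are taken over finite trees and treated by induction on the depth: `leafSum`,
`nodeSum` and `hitSet` describe the leaves, the subdivided cubes and the set covered by some of the
leaves.
-/

noncomputable section

/-! ### Geometry of dyadic cubes -/

namespace DyadicCube

variable {n : ℕ}

lemma side_pos (Q : DyadicCube n) : 0 < Q.side := zpow_pos two_pos _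

lemma corner_mem (Q : DyadicCube n) : Q.corner ∈ Q.carrier :=
  fun i => ⟨le_rfl, by linarith [Q.side_pos]⟩

lemma carrier_eq_pi (Q : DyadicCube n) :
    Q.carrier = Set.pi univ fun i => Ico (Q.corner i) (Q.corner i + Q.side) := by
  ext x; simp [carrier]

lemma measurableSet_carrier (Q : DyadicCube n) : MeasurableSet Q.carrier := by
  rw [carrier_eq_pi]; exact MeasurableSet.univ_pi fun _ => measurableSet_Ico

lemma volume_carrier (Q : DyadicCube n) : volume Q.carrier = ENNReal.ofReal (Q.side ^ n) := by
  rw [carrier_eq_pi, Real.volume_pi_Ico]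
  simp [ENNReal.ofReal_pow Q.side_pos.le]

lemma vol_eq (Q : DyadicCube n) : Q.vol = Q.side ^ n := by
  rw [vol, Measure.real, volume_carrier, ENNReal.toReal_ofReal (pow_nonneg Q.side_pos.le _)]

lemma vol_pos (Q : DyadicCube n) : 0 < Q.vol := by
  rw [vol_eq]; exact pow_pos Q.side_pos _

lemma volume_eq_ofReal_vol (Q : DyadicCube n) : volume Q.carrier = ENNReal.ofReal Q.vol := by
  rw [vol_eq, volume_carrier]

lemma volume_ne_top (Q : DyadicCube n) : volume Q.carrier ≠ ∞ := by
  rw [volume_carrier]; exact ENNReal.ofReal_ne_top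

lemma nonempty_interior (Q : DyadicCube n) : (interior Q.carrier).Nonempty := by
  refine ⟨fun i => Q.corner i + Q.side / 2, mem_interior.2
    ⟨Set.pi univ fun i => Ioo (Q.corner i) (Q.corner i + Q.side), ?_,
      isOpen_set_pi finite_univ fun _ _ => isOpen_Ioo, ?_⟩⟩
  · rw [carrier_eq_pi]; exact pi_mono fun i _ => Ioo_subset_Ico_self
  · intro i _
    have := Q.side_pos
    exact ⟨by linarith, by linarith⟩

/-- A locally integrable function is integrable over every cube. -/
lemma integrableOn_of_locallyIntegrable {g : (Fin n → ℝ) → ℝ} (hg : LocallyIntegrable g volume)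
    (Q : DyadicCube n) : IntegrableOn g Q.carrier volume := by
  refine (hg.integrableOn_isCompact (isCompact_Icc
    (a := Q.corner) (b := fun i => Q.corner i + Q.side))).mono_set fun x hx => ?_
  exact ⟨fun i => (hx i).1, fun i => (hx i).2.le⟩

lemma scale_le_of_subset (hn : 0 < n) {P Q : DyadicCube n} (h : P.carrier ⊆ Q.carrier) :
    P.scale ≤ Q.scale := by
  have h1 := measure_mono (μ := volume) h
  rw [volume_carrier, volume_carrier,
    ENNReal.ofReal_le_ofReal_iff (pow_nonneg Q.side_pos.le _)] at h1
  have h2 : P.side ≤ Q.side := le_of_pow_le_pow_left₀ hn.ne' Q.side_pos.le h1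
  exact (zpow_le_zpow_iff_right₀ (by norm_num : (1 : ℝ) < 2)).1 h2

/-- The child of the cube `Q` which in the direction `i` is the right half of `Q` if `σ i` and the
left half otherwise. -/
def child (Q : DyadicCube n) (σ : Fin n → Bool) : DyadicCube n :=
  ⟨fun i => Q.corner i + if σ i then Q.side / 2 else 0, Q.scale - 1⟩

@[simp] lemma child_scale (Q : DyadicCube n) (σ : Fin n → Bool) :
    (Q.child σ).scale = Q.scale - 1 := rfl

@[simp] lemma child_side (Q : DyadicCube n) (σ : Fin n → Bool) :
    (Q.child σ).side = Q.side / 2 := by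
  simp [side, zpow_sub₀ (two_ne_zero' ℝ)]

lemma child_vol (Q : DyadicCube n) (σ : Fin n → Bool) : (Q.child σ).vol = Q.vol / 2 ^ n := by
  rw [vol_eq, vol_eq, child_side, div_pow]

lemma mem_child {Q : DyadicCube n} {σ : Fin n → Bool} {x : Fin n → ℝ} :
    x ∈ (Q.child σ).carrier ↔
      ∀ i, Q.corner i + (if σ i then Q.side / 2 else 0) ≤ x i ∧
        x i < Q.corner i + (if σ i then Q.side else Q.side / 2) := by
  refine forall_congr' fun i => ?_
  rw [mem_Ico, child_side]
  cases h : σ i <;> simp [child, h, add_assoc]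

lemma child_subset (Q : DyadicCube n) (σ : Fin n → Bool) : (Q.child σ).carrier ⊆ Q.carrier := by
  intro x hx i
  have h := mem_child.1 hx i
  have := Q.side_pos
  cases h' : σ i <;> simp only [h', if_true, Bool.false_eq_true, if_false] at h <;>
    exact ⟨by linarith, by linarith⟩

/-- The address of the child of `Q` that contains the point `x`. -/
def childAddress (Q : DyadicCube n) (x : Fin n → ℝ) : Fin n → Bool :=
  fun i => decide (Q.corner i + Q.side / 2 ≤ x i)

lemma mem_child_childAddress {Q : DyadicCube n} {x : Fin n → ℝ} (hx : x ∈ Q.carrier) :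
    x ∈ (Q.child (Q.childAddress x)).carrier := by
  refine mem_child.2 fun i => ?_
  have h := hx i
  by_cases h' : Q.corner i + Q.side / 2 ≤ x i
  · simp only [childAddress, h', decide_true, if_true]
    exact ⟨trivial, h.2⟩
  · simp only [childAddress, h', decide_false, Bool.false_eq_true, if_false]
    exact ⟨by linarith [h.1], not_le.1 h'⟩

lemma eq_childAddress {Q : DyadicCube n} {σ : Fin n → Bool} {x : Fin n → ℝ}
    (hx : x ∈ (Q.child σ).carrier) : σ = Q.childAddress x := by
  funext i
  have h := mem_child.1 hx i
  cases h' : σ i <;> simp only [h', if_true, Bool.false_eq_true, if_false] at h <;>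
    simp only [childAddress]
  · exact (decide_eq_false (not_le.2 h.2)).symm
  · exact (decide_eq_true h.1).symm

lemma child_disjoint (Q : DyadicCube n) :
    Pairwise (Function.onFun Disjoint fun σ => (Q.child σ).carrier) := by
  intro σ τ h
  refine Set.disjoint_left.2 fun x hx hx' => h ?_
  rw [eq_childAddress hx, eq_childAddress hx']

lemma iUnion_child (Q : DyadicCube n) : ⋃ σ, (Q.child σ).carrier = Q.carrier :=
  Subset.antisymm (iUnion_subset Q.child_subset)
    fun _ hx => mem_iUnion.2 ⟨_, mem_child_childAddress hx⟩

lemma integral_eq_sum_child {Q : DyadicCube n} {g : (Fin n → ℝ) → ℝ}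
    (hg : IntegrableOn g Q.carrier volume) :
    ∫ x in Q.carrier, g x = ∑ σ, ∫ x in (Q.child σ).carrier, g x := by
  rw [← Q.iUnion_child, integral_iUnion_fintype (fun σ => (Q.child σ).measurableSet_carrier)
    Q.child_disjoint fun σ => hg.mono_set (Q.child_subset σ)]

lemma sum_child_vol (Q : DyadicCube n) : ∑ σ, (Q.child σ).vol = Q.vol := by
  simp [child_vol, mul_div_cancel₀]

end DyadicCube

namespace DyadicGrid

variable {n : ℕ} (D : DyadicGrid n)

/-- The cube of side length `2 ^ k` of the grid that contains the point `x`. -/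
def cubeAt (k : ℤ) (x : Fin n → ℝ) : DyadicCube n := (D.partition k x).choose

lemma cubeAt_mem (k : ℤ) (x : Fin n → ℝ) : D.cubeAt k x ∈ D.cubes :=
  (D.partition k x).choose_spec.1.1

@[simp] lemma cubeAt_scale (k : ℤ) (x : Fin n → ℝ) : (D.cubeAt k x).scale = k :=
  (D.partition k x).choose_spec.1.2.1

lemma mem_cubeAt (k : ℤ) (x : Fin n → ℝ) : x ∈ (D.cubeAt k x).carrier :=
  (D.partition k x).choose_spec.1.2.2

variable {D}

lemma eq_cubeAt {Q : DyadicCube n} (hQ : Q ∈ D.cubes) {x : Fin n → ℝ} (hx : x ∈ Q.carrier) :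
    Q = D.cubeAt Q.scale x :=
  (D.partition Q.scale x).choose_spec.2 Q ⟨hQ, rfl, hx⟩

lemma cubeAt_eq {Q : DyadicCube n} (hQ : Q ∈ D.cubes) {x : Fin n → ℝ} (hx : x ∈ Q.carrier) {k : ℤ}
    (hk : Q.scale = k) : D.cubeAt k x = Q := by
  rw [← hk]; exact (eq_cubeAt hQ hx).symm

lemma subset_of_scale_le (hn : 0 < n) {P Q : DyadicCube n} (hP : P ∈ D.cubes) (hQ : Q ∈ D.cubes)
    {x : Fin n → ℝ} (hxP : x ∈ P.carrier) (hxQ : x ∈ Q.carrier) (h : P.scale ≤ Q.scale) :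
    P.carrier ⊆ Q.carrier := by
  rcases D.nested P hP Q hQ with h1 | h1 | h1
  · exact inter_eq_left.1 h1
  · have h2 := inter_eq_right.1 h1
    have h3 := le_antisymm h (DyadicCube.scale_le_of_subset hn h2)
    rw [eq_cubeAt hP hxP, eq_cubeAt hQ hxQ, h3]
  · exact absurd (h1 ▸ (⟨hxP, hxQ⟩ : x ∈ P.carrier ∩ Q.carrier)) (notMem_empty x)

/-- Each half-size subcube of a cube of the grid belongs to the grid. -/
lemma child_mem (hn : 0 < n) {Q : DyadicCube n} (hQ : Q ∈ D.cubes) (σ : Fin n → Bool) :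
    Q.child σ ∈ D.cubes := by
  have hs := Q.side_pos
  -- a grid cube of half the side inside `Q` starts, in each direction, at the left end or at the
  -- midpoint: otherwise it would meet the grid cube that starts at the left end
  have key : ∀ P ∈ D.cubes, P.scale = Q.scale - 1 → P.carrier ⊆ Q.carrier → ∀ i,
      P.corner i < Q.corner i + Q.side / 2 → P.corner i = Q.corner i := by
    intro P hP hPs hPQ i hi
    have hside : P.side = Q.side / 2 := by
      simp [DyadicCube.side, hPs, zpow_sub₀ (two_ne_zero' ℝ)]
    have hc := hPQ P.corner_mem
    set y := Function.update P.corner i (Q.corner i) with hy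
    have hyQ : y ∈ Q.carrier := by
      intro j
      by_cases hj : j = i
      · subst hj; simp only [hy, Function.update_self]; exact ⟨le_rfl, by linarith⟩
      · simp only [hy, Function.update_of_ne hj]; exact hc j
    set P' := D.cubeAt (Q.scale - 1) y with hP'
    have hP'm : P' ∈ D.cubes := D.cubeAt_mem _ _
    have hyP' : y ∈ P'.carrier := D.mem_cubeAt _ _
    have hside' : P'.side = Q.side / 2 := by
      simp [DyadicCube.side, hP', zpow_sub₀ (two_ne_zero' ℝ)]
    have hP'Q : P'.carrier ⊆ Q.carrier :=
      subset_of_scale_le hn hP'm hQ hyP' hyQ (by simp [hP'])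
    have h1 : P'.corner i = Q.corner i :=
      le_antisymm (by simpa [hy] using (hyP' i).1) (hP'Q P'.corner_mem i).1
    have h2 : P.corner ∈ P'.carrier := by
      intro j
      by_cases hj : j = i
      · subst hj; rw [h1, hside']; exact ⟨(hc j).1, hi⟩
      · simpa [hy, Function.update_of_ne hj] using hyP' j
    have h3 : P = P' := by
      rw [eq_cubeAt hP P.corner_mem, eq_cubeAt hP'm h2, hPs, hP', cubeAt_scale]
    rw [h3, h1]
  set p := (Q.child σ).corner with hp
  set P := D.cubeAt (Q.scale - 1) p with hP
  have hpP : p ∈ P.carrier := D.mem_cubeAt _ _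
  have hpQ : p ∈ Q.carrier := Q.child_subset σ (Q.child σ).corner_mem
  have hPQ : P.carrier ⊆ Q.carrier :=
    subset_of_scale_le hn (D.cubeAt_mem _ _) hQ hpP hpQ (by simp [hP])
  have hside : P.side = Q.side / 2 := by
    simp [DyadicCube.side, hP, zpow_sub₀ (two_ne_zero' ℝ)]
  have hPm : P ∈ D.cubes := D.cubeAt_mem _ _
  have hPsc : P.scale = Q.scale - 1 := D.cubeAt_scale _ _
  have : Q.child σ = P := by
    have hcor : p = P.corner := by
      funext i
      have h1 := hpP i
      have h2 := hPQ P.corner_mem i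
      have h4 : p i = Q.corner i + if σ i then Q.side / 2 else 0 := rfl
      rw [h4] at h1 ⊢
      rw [hside] at h1
      cases hσ : σ i <;> simp only [hσ, if_true, Bool.false_eq_true, if_false] at h1 ⊢
      · linarith [h1.1, h2.1]
      · by_contra hne
        have h5 : P.corner i < Q.corner i + Q.side / 2 := lt_of_le_of_ne h1.1 (Ne.symm hne)
        have h6 := key P hPm hPsc hPQ i h5
        linarith [h1.2]
    rw [← (show (⟨p, Q.scale - 1⟩ : DyadicCube n) = Q.child σ from rfl), hcor, ← hPsc]
  rw [this]; exact hPm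

lemma countable_cubes : D.cubes.Countable := by
  have h : D.cubes = ⋃ k : ℤ, {Q | Q ∈ D.cubes ∧ Q.scale = k} := by
    ext Q; simp
  rw [h]
  refine countable_iUnion fun k => ?_
  refine Set.PairwiseDisjoint.countable_of_nonempty_interior (s := DyadicCube.carrier) ?_
    fun Q _ => Q.nonempty_interior
  intro P hP Q hQ hne
  refine Set.disjoint_left.2 fun x hxP hxQ => hne ?_
  rw [eq_cubeAt hP.1 hxP, eq_cubeAt hQ.1 hxQ, hP.2, hQ.2]

variable (D) in
/-- The `j`-th generation cube below `Q` at the point `x`. -/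
def descend (Q : DyadicCube n) (x : Fin n → ℝ) (j : ℕ) : DyadicCube n :=
  D.cubeAt (Q.scale - j) x

variable (D) in
@[simp] lemma descend_scale (Q : DyadicCube n) (x : Fin n → ℝ) (j : ℕ) :
    (D.descend Q x j).scale = Q.scale - j := cubeAt_scale _ _ _

variable (D) in
lemma descend_mem (Q : DyadicCube n) (x : Fin n → ℝ) (j : ℕ) : D.descend Q x j ∈ D.cubes :=
  cubeAt_mem _ _ _

variable (D) in
lemma mem_descend (Q : DyadicCube n) (x : Fin n → ℝ) (j : ℕ) :
    x ∈ (D.descend Q x j).carrier := mem_cubeAt _ _ _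

lemma descend_zero {Q : DyadicCube n} (hQ : Q ∈ D.cubes) {x : Fin n → ℝ} (hx : x ∈ Q.carrier) :
    D.descend Q x 0 = Q := cubeAt_eq hQ hx (by simp)

variable (D) in
lemma descend_descend (Q : DyadicCube n) (x : Fin n → ℝ) (i j : ℕ) :
    D.descend (D.descend Q x i) x j = D.descend Q x (i + j) := by
  simp only [descend, cubeAt_scale]; congr 1; push_cast; ring

lemma descend_subset (hn : 0 < n) (Q : DyadicCube n) (x : Fin n → ℝ) {i j : ℕ} (h : i ≤ j) :
    (D.descend Q x j).carrier ⊆ (D.descend Q x i).carrier :=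
  subset_of_scale_le hn (D.descend_mem _ _ _) (D.descend_mem _ _ _) (D.mem_descend _ _ _)
    (D.mem_descend _ _ _) (by simp; omega)

lemma descend_subset_self (hn : 0 < n) {Q : DyadicCube n} (hQ : Q ∈ D.cubes) {x : Fin n → ℝ}
    (hx : x ∈ Q.carrier) (j : ℕ) : (D.descend Q x j).carrier ⊆ Q.carrier := by
  simpa [descend_zero hQ hx] using descend_subset (D := D) hn Q x (Nat.zero_le j)

lemma descend_child (hn : 0 < n) {Q : DyadicCube n} (hQ : Q ∈ D.cubes) {σ : Fin n → Bool}
    {x : Fin n → ℝ} (hx : x ∈ (Q.child σ).carrier) (j : ℕ) :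
    D.descend (Q.child σ) x j = D.descend Q x (j + 1) := by
  have : Q.child σ = D.descend Q x 1 :=
    (cubeAt_eq (child_mem hn hQ σ) hx (by simp)).symm
  rw [this, descend_descend, add_comm]

/-- Two points of a cube have the same cubes above it. -/
lemma descend_congr (hn : 0 < n) {Q : DyadicCube n} {x y : Fin n → ℝ} {i j : ℕ}
    (hy : y ∈ (D.descend Q x j).carrier) (h : i ≤ j) : D.descend Q y i = D.descend Q x i :=
  cubeAt_eq (D.descend_mem _ _ _) (descend_subset hn Q x h hy) (by simp)

/-- A cube of the grid below `Q` is one of the cubes that descend from `Q` at its points. -/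
lemma eq_descend (hn : 0 < n) {P Q : DyadicCube n} (hP : P ∈ D.cubes) (h : P.carrier ⊆ Q.carrier)
    {x : Fin n → ℝ} (hx : x ∈ P.carrier) : P = D.descend Q x (Q.scale - P.scale).toNat := by
  have h1 := DyadicCube.scale_le_of_subset hn h
  exact (cubeAt_eq hP hx (by rw [Int.toNat_of_nonneg (by omega)]; ring)).symm

end DyadicGrid

/-! ### Sums over finite trees of stopped cubes -/

section Tree

variable {n : ℕ} {st hit : DyadicCube n → Prop} {φ ψ : DyadicCube n → ℝ}

open Classical in
/-- The sum of `φ` over the leaves of the tree of cubes that grows from a root by subdividing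
the cubes without the property `st`, for at most `k` generations. -/
def leafSum (st : DyadicCube n → Prop) (φ : DyadicCube n → ℝ) : ℕ → DyadicCube n → ℝ
  | 0, R => φ R
  | k + 1, R => if st R then φ R else ∑ σ, leafSum st φ k (R.child σ)

open Classical in
/-- The sum of `ψ` over the subdivided cubes of the tree of `leafSum`. -/
def nodeSum (st : DyadicCube n → Prop) (ψ : DyadicCube n → ℝ) : ℕ → DyadicCube n → ℝ
  | 0, _ => 0
  | k + 1, R => if st R then 0 else ψ R + ∑ σ, nodeSum st ψ k (R.child σ)

open Classical in
/-- The union of those leaves of the tree of `leafSum` that have the property `hit`. -/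
def hitSet (st hit : DyadicCube n → Prop) : ℕ → DyadicCube n → Set (Fin n → ℝ)
  | 0, R => if hit R then R.carrier else ∅
  | k + 1, R => if st R then (if hit R then R.carrier else ∅)
      else ⋃ σ, hitSet st hit k (R.child σ)

/-- Telescoping over a tree. -/
lemma leafSum_eq (k : ℕ) (R : DyadicCube n) :
    leafSum st φ k R = φ R + nodeSum st (fun R => ∑ σ, φ (R.child σ) - φ R) k R := by
  induction k generalizing R with
  | zero => simp [leafSum, nodeSum]
  | succ k ih =>
    by_cases h : st R
    · simp [leafSum, nodeSum, h]
    · simp only [leafSum, nodeSum, h, if_false, ih, Finset.sum_add_distrib]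
      ring

lemma leafSum_mono {I : DyadicCube n → Prop} (hI : ∀ R, I R → ¬ st R → ∀ σ, I (R.child σ))
    {φ' : DyadicCube n → ℝ} (h : ∀ R, I R → φ R ≤ φ' R) {k : ℕ} {R : DyadicCube n} (hR : I R) :
    leafSum st φ k R ≤ leafSum st φ' k R := by
  induction k generalizing R with
  | zero => exact h R hR
  | succ k ih =>
    by_cases hs : st R
    · simpa [leafSum, hs] using h R hR
    · simp only [leafSum, hs, if_false]
      exact Finset.sum_le_sum fun σ _ => ih (hI R hR hs σ)

lemma nodeSum_mono {I : DyadicCube n → Prop} (hI : ∀ R, I R → ¬ st R → ∀ σ, I (R.child σ))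
    {ψ' : DyadicCube n → ℝ} (h : ∀ R, I R → ¬ st R → ψ R ≤ ψ' R) {k : ℕ} {R : DyadicCube n}
    (hR : I R) : nodeSum st ψ k R ≤ nodeSum st ψ' k R := by
  induction k generalizing R with
  | zero => exact le_rfl
  | succ k ih =>
    by_cases hs : st R
    · simp [nodeSum, hs]
    · simp only [nodeSum, hs, if_false]
      exact add_le_add (h R hR hs) (Finset.sum_le_sum fun σ _ => ih (hI R hR hs σ))

lemma nodeSum_nonneg (h : ∀ R, 0 ≤ ψ R) (k : ℕ) (R : DyadicCube n) : 0 ≤ nodeSum st ψ k R := by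
  induction k generalizing R with
  | zero => exact le_rfl
  | succ k ih =>
    by_cases hs : st R
    · simp [nodeSum, hs]
    · simp only [nodeSum, hs, if_false]
      exact add_nonneg (h R) (Finset.sum_nonneg fun σ _ => ih _)

/-- A stronger stopping condition gives a smaller tree. -/
lemma nodeSum_anti {st' : DyadicCube n → Prop} (hst : ∀ R, st R → st' R) (h : ∀ R, 0 ≤ ψ R)
    (k : ℕ) (R : DyadicCube n) : nodeSum st' ψ k R ≤ nodeSum st ψ k R := by
  induction k generalizing R with
  | zero => exact le_rfl
  | succ k ih =>
    by_cases hs : st' R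
    · have := nodeSum_nonneg (st := st) h (k + 1) R
      simpa only [nodeSum, hs, if_true] using this
    · have hs' : ¬ st R := fun h => hs (hst R h)
      simp only [nodeSum, hs, hs', if_false]
      exact add_le_add le_rfl (Finset.sum_le_sum fun σ _ => ih _)

lemma nodeSum_mono_depth (h : ∀ R, 0 ≤ ψ R) (R : DyadicCube n) :
    Monotone fun k => nodeSum st ψ k R := by
  refine monotone_nat_of_le_succ fun k => ?_
  induction k generalizing R with
  | zero => exact nodeSum_nonneg h _ _
  | succ k ih =>
    by_cases hs : st R
    · simp [nodeSum, hs]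
    · simp only [nodeSum, hs, if_false]
      exact add_le_add le_rfl (Finset.sum_le_sum fun σ _ => ih _)

lemma nodeSum_const_mul (c : ℝ) (k : ℕ) (R : DyadicCube n) :
    nodeSum st (fun R => c * ψ R) k R = c * nodeSum st ψ k R := by
  induction k generalizing R with
  | zero => simp [nodeSum]
  | succ k ih =>
    by_cases hs : st R
    · simp [nodeSum, hs]
    · simp only [nodeSum, hs, if_false, ih, mul_add, Finset.mul_sum]

lemma nodeSum_add (ψ' : DyadicCube n → ℝ) (k : ℕ) (R : DyadicCube n) :
    nodeSum st (fun R => ψ R + ψ' R) k R = nodeSum st ψ k R + nodeSum st ψ' k R := by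
  induction k generalizing R with
  | zero => simp [nodeSum]
  | succ k ih =>
    by_cases hs : st R
    · simp [nodeSum, hs]
    · simp only [nodeSum, hs, if_false, ih, Finset.sum_add_distrib]
      ring

lemma leafSum_const_mul (c : ℝ) (k : ℕ) (R : DyadicCube n) :
    leafSum st (fun R => c * φ R) k R = c * leafSum st φ k R := by
  induction k generalizing R with
  | zero => simp [leafSum]
  | succ k ih =>
    by_cases hs : st R
    · simp [leafSum, hs]
    · simp only [leafSum, hs, if_false, ih, Finset.mul_sum]

lemma leafSum_add (φ' : DyadicCube n → ℝ) (k : ℕ) (R : DyadicCube n) :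
    leafSum st (fun R => φ R + φ' R) k R = leafSum st φ k R + leafSum st φ' k R := by
  induction k generalizing R with
  | zero => simp [leafSum]
  | succ k ih =>
    by_cases hs : st R
    · simp [leafSum, hs]
    · simp only [leafSum, hs, if_false, ih, Finset.sum_add_distrib]

/-- The leaves of a tree partition its root. -/
lemma leafSum_integral {g : (Fin n → ℝ) → ℝ} (k : ℕ) {R : DyadicCube n}
    (hg : IntegrableOn g R.carrier volume) :
    leafSum st (fun R => ∫ x in R.carrier, g x) k R = ∫ x in R.carrier, g x := by
  induction k generalizing R with
  | zero => simp [leafSum]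
  | succ k ih =>
    by_cases hs : st R
    · simp [leafSum, hs]
    · simp only [leafSum, hs, if_false]
      rw [DyadicCube.integral_eq_sum_child hg]
      exact Finset.sum_congr rfl fun σ _ => ih (hg.mono_set (R.child_subset σ))

/-- The sum over the nodes beyond generation `K` is the difference of two sums over nodes. -/
lemma nodeSum_cut {c : ℤ} {K k : ℕ} (hk : K ≤ k) {R : DyadicCube n} (hR : R.scale = c + K) :
    nodeSum st (fun R => if R.scale ≤ c then ψ R else 0) k R + nodeSum st ψ K R
      = nodeSum st ψ k R := by
  induction K generalizing R k with
  | zero =>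
    simp only [nodeSum, add_zero]
    have hR' : R.scale ≤ c := by simp [hR]
    clear hR hk
    induction k generalizing R with
    | zero => rfl
    | succ k ih =>
      by_cases hs : st R
      · simp [nodeSum, hs]
      · simp only [nodeSum, hs, if_false, hR', if_true]
        congr 1
        exact Finset.sum_congr rfl fun σ _ => ih (by simp; omega)
  | succ K ih =>
    obtain ⟨k, rfl⟩ : ∃ l, k = l + 1 := ⟨k - 1, by omega⟩
    by_cases hs : st R
    · simp [nodeSum, hs]
    · have hR' : ¬ R.scale ≤ c := by rw [hR]; push_cast; omega
      simp only [nodeSum, hs, if_false, hR', zero_add]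
      rw [add_left_comm, ← Finset.sum_add_distrib]
      congr 1
      exact Finset.sum_congr rfl fun σ _ =>
        ih (by omega) (by rw [DyadicCube.child_scale, hR]; push_cast; ring)

lemma hitSet_subset (k : ℕ) (R : DyadicCube n) : hitSet st hit k R ⊆ R.carrier := by
  induction k generalizing R with
  | zero => by_cases hh : hit R <;> simp [hitSet, hh]
  | succ k ih =>
    by_cases hs : st R
    · by_cases hh : hit R <;> simp [hitSet, hs, hh]
    · simp only [hitSet, hs, if_false]
      exact iUnion_subset fun σ => (ih _).trans (R.child_subset σ)

lemma measurableSet_hitSet (k : ℕ) (R : DyadicCube n) : MeasurableSet (hitSet st hit k R) := by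
  induction k generalizing R with
  | zero => by_cases hh : hit R <;> simp [hitSet, hh, R.measurableSet_carrier]
  | succ k ih =>
    by_cases hs : st R
    · by_cases hh : hit R <;> simp [hitSet, hs, hh, R.measurableSet_carrier]
    · simp only [hitSet, hs, if_false]
      exact MeasurableSet.iUnion fun σ => ih _

lemma hitSet_mono (h : ∀ R, hit R → st R) (R : DyadicCube n) :
    Monotone fun k => hitSet st hit k R := by
  refine monotone_nat_of_le_succ fun k => ?_
  induction k generalizing R with
  | zero =>
    by_cases hh : hit R
    · simp [hitSet, hh, h R hh]
    · simp [hitSet, hh]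
  | succ k ih =>
    by_cases hs : st R
    · simp [hitSet, hs]
    · simp only [hitSet, hs, if_false]
      exact iUnion_mono fun σ => ih _

/-- The measure of the union of the hit leaves is controlled by any nonnegative potential that is
at least the volume on these leaves. -/
lemma volume_hitSet_le {I : DyadicCube n → Prop}
    (hI : ∀ R, I R → ¬ st R → ∀ σ, I (R.child σ)) (h0 : ∀ R, I R → 0 ≤ φ R)
    (hφ : ∀ R, I R → hit R → R.vol ≤ φ R) {k : ℕ} {R : DyadicCube n} (hR : I R) :
    volume (hitSet st hit k R) ≤ ENNReal.ofReal (leafSum st φ k R) ∧ 0 ≤ leafSum st φ k R := by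
  induction k generalizing R with
  | zero =>
    refine ⟨?_, h0 R hR⟩
    by_cases hh : hit R
    · simpa [hitSet, hh, leafSum, R.volume_eq_ofReal_vol] using
        ENNReal.ofReal_le_ofReal (hφ R hR hh)
    · simp [hitSet, hh]
  | succ k ih =>
    by_cases hs : st R
    · simp only [hitSet, leafSum, hs, if_true]
      refine ⟨?_, h0 R hR⟩
      by_cases hh : hit R
      · simpa [hh, R.volume_eq_ofReal_vol] using ENNReal.ofReal_le_ofReal (hφ R hR hh)
      · simp [hh]
    · simp only [hitSet, leafSum, hs, if_false]
      have h := fun σ => ih (hI R hR hs σ)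
      refine ⟨?_, Finset.sum_nonneg fun σ _ => (h σ).2⟩
      rw [ENNReal.ofReal_sum_of_nonneg fun σ _ => (h σ).2]
      refine (measure_iUnion_le _).trans ?_
      rw [tsum_fintype]
      exact Finset.sum_le_sum fun σ _ => (h σ).1

lemma volume_iUnion_hitSet_le {I : DyadicCube n → Prop} (hhit : ∀ R, hit R → st R)
    (hI : ∀ R, I R → ¬ st R → ∀ σ, I (R.child σ)) (h0 : ∀ R, I R → 0 ≤ φ R)
    (hφ : ∀ R, I R → hit R → R.vol ≤ φ R) {R : DyadicCube n} (hR : I R) {M : ℝ}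
    (hM : ∀ k, leafSum st φ k R ≤ M) :
    volume (⋃ k, hitSet st hit k R) ≤ ENNReal.ofReal M := by
  rw [(hitSet_mono hhit R).measure_iUnion]
  exact iSup_le fun k =>
    (volume_hitSet_le hI h0 hφ hR).1.trans (ENNReal.ofReal_le_ofReal (hM k))

/-- A point lies in the hit set if one of the cubes that descend to it is hit, and no earlier one
is stopped. -/
lemma mem_hitSet {D : DyadicGrid n} (hn : 0 < n) {R : DyadicCube n} (hR : R ∈ D.cubes)
    {x : Fin n → ℝ} (hx : x ∈ R.carrier) {j : ℕ} (hj : hit (D.descend R x j))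
    (hlt : ∀ i < j, ¬ st (D.descend R x i)) : x ∈ hitSet st hit j R := by
  induction j generalizing R with
  | zero =>
    rw [DyadicGrid.descend_zero hR hx] at hj
    simpa [hitSet, hj] using hx
  | succ j ih =>
    have h0 := hlt 0 (Nat.succ_pos j)
    rw [DyadicGrid.descend_zero hR hx] at h0
    simp only [hitSet, h0, if_false]
    have hc := DyadicCube.mem_child_childAddress hx
    refine mem_iUnion.2 ⟨R.childAddress x, ih (DyadicGrid.child_mem hn hR _) hc ?_ ?_⟩
    · rwa [DyadicGrid.descend_child hn hR hc]
    · intro i hi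
      rw [DyadicGrid.descend_child hn hR hc]
      exact hlt _ (by omega)

/-- A point below which some cube is stopped lies in the union of the stopped leaves. -/
lemma mem_iUnion_hitSet {D : DyadicGrid n} (hn : 0 < n) {R : DyadicCube n} (hR : R ∈ D.cubes)
    {x : Fin n → ℝ} (hx : x ∈ R.carrier) {j : ℕ} (hj : st (D.descend R x j)) :
    x ∈ ⋃ k, hitSet st st k R := by
  classical
  have hex : ∃ j, st (D.descend R x j) := ⟨j, hj⟩
  exact mem_iUnion.2 ⟨Nat.find hex, mem_hitSet hn hR hx (Nat.find_spec hex)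
    fun i hi => Nat.find_min hex hi⟩

end Tree

/-! ### Terms that are constant on the children of their cube -/

section Terms

variable {n : ℕ}

/-- The term `T Q` of each cube `Q` is supported in `Q` and constant on each child of `Q`. -/
structure IsHaarLike (T : DyadicCube n → (Fin n → ℝ) → ℝ) : Prop where
  zero_of_notMem : ∀ Q x, x ∉ Q.carrier → T Q x = 0
  const_child : ∀ Q σ x y, x ∈ (DyadicCube.child Q σ).carrier → y ∈ (Q.child σ).carrier →
    T Q x = T Q y

/-- The sum of the terms of the cubes `P` with `R ⊊ P ⊆ Q` at the points of `R`; it is evaluated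
at the corner of `R`. -/
def sumAbove (D : DyadicGrid n) (T : DyadicCube n → (Fin n → ℝ) → ℝ) (Q R : DyadicCube n) : ℝ :=
  ∑ i ∈ Finset.range (Q.scale - R.scale).toNat, T (D.descend Q R.corner i) R.corner

variable {D : DyadicGrid n} {T : DyadicCube n → (Fin n → ℝ) → ℝ}

lemma IsHaarLike.eq_of_mem (hT : IsHaarLike T) (hn : 0 < n) {P R : DyadicCube n}
    (hP : P ∈ D.cubes) (hR : R ∈ D.cubes) (h : R.scale < P.scale) {x y : Fin n → ℝ}
    (hx : x ∈ R.carrier) (hy : y ∈ R.carrier) : T P x = T P y := by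
  by_cases hxP : x ∈ P.carrier
  · have hc := DyadicCube.mem_child_childAddress hxP
    have hsub := DyadicGrid.subset_of_scale_le hn hR (DyadicGrid.child_mem hn hP _) hx hc
      (by simp; omega)
    exact hT.const_child P _ x y hc (hsub hy)
  · have hyP : y ∉ P.carrier := fun hyP =>
      hxP (DyadicGrid.subset_of_scale_le hn hR hP hy hyP h.le hx)
    rw [hT.zero_of_notMem P x hxP, hT.zero_of_notMem P y hyP]

lemma sumAbove_descend (hT : IsHaarLike T) (hn : 0 < n) (Q : DyadicCube n) (x : Fin n → ℝ)
    (j : ℕ) : sumAbove D T Q (D.descend Q x j) =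
      ∑ i ∈ Finset.range j, T (D.descend Q x i) x := by
  have h : (Q.scale - (D.descend Q x j).scale).toNat = j := by simp
  rw [sumAbove, h]
  refine Finset.sum_congr rfl fun i hi => ?_
  have hi' := Finset.mem_range.1 hi
  rw [DyadicGrid.descend_congr hn (DyadicCube.corner_mem _) hi'.le]
  exact hT.eq_of_mem hn (D.descend_mem _ _ _) (D.descend_mem Q x j) (by simp; omega)
    (DyadicCube.corner_mem _) (D.mem_descend _ _ _)

@[simp] lemma sumAbove_self (Q : DyadicCube n) : sumAbove D T Q Q = 0 := by simp [sumAbove]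

lemma sumAbove_child (hT : IsHaarLike T) (hn : 0 < n) {Q R : DyadicCube n}
    (hR : R ∈ D.cubes) (h : R.carrier ⊆ Q.carrier) (σ : Fin n → Bool) :
    sumAbove D T Q (R.child σ) = sumAbove D T Q R + T R (R.child σ).corner := by
  set x := (R.child σ).corner with hx
  have hxc : x ∈ (R.child σ).carrier := DyadicCube.corner_mem _
  have hxR : x ∈ R.carrier := R.child_subset σ hxc
  have h1 := DyadicGrid.eq_descend hn hR h hxR
  have h2 := DyadicGrid.eq_descend hn (DyadicGrid.child_mem hn hR σ)
    ((R.child_subset σ).trans h) hxc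
  have h3 := DyadicCube.scale_le_of_subset hn h
  have h4 : (Q.scale - (R.child σ).scale).toNat = (Q.scale - R.scale).toNat + 1 := by
    rw [DyadicCube.child_scale]; omega
  rw [h4] at h2
  rw [h2, sumAbove_descend hT hn, Finset.sum_range_succ, ← h1]
  congr 1
  conv_rhs => rw [h1]
  rw [sumAbove_descend hT hn]

end Terms

/-! ### Greedy stopping indices -/

section LastStop

open Classical in
/-- The last greedy stopping index up to `k`: the index `0` is one, and after the stopping index
`i` the next one is the least `j > i` with `p i j`. -/
def lastStop (p : ℕ → ℕ → Prop) : ℕ → ℕ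
  | 0 => 0
  | k + 1 => if p (lastStop p k) (k + 1) then k + 1 else lastStop p k

variable {p q : ℕ → ℕ → Prop}

lemma lastStop_le (k : ℕ) : lastStop p k ≤ k := by
  induction k with
  | zero => exact le_rfl
  | succ k ih => rw [lastStop]; split_ifs <;> omega

lemma lastStop_mono : Monotone (lastStop p) := by
  refine monotone_nat_of_le_succ fun k => ?_
  have := lastStop_le (p := p) k
  rw [lastStop]; split_ifs <;> omega

lemma lastStop_lastStop (k : ℕ) : lastStop p (lastStop p k) = lastStop p k := by
  induction k with
  | zero => rfl
  | succ k ih =>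
    by_cases h : p (lastStop p k) (k + 1)
    · have : lastStop p (k + 1) = k + 1 := by rw [lastStop, if_pos h]
      rw [this, this]
    · have : lastStop p (k + 1) = lastStop p k := by rw [lastStop, if_neg h]
      rw [this, ih]

lemma not_of_lastStop_lt {j k : ℕ} (hj : lastStop p k < j) (hk : j ≤ k) :
    ¬ p (lastStop p k) j := by
  induction k with
  | zero => omega
  | succ k ih =>
    by_cases h : p (lastStop p k) (k + 1)
    · have : lastStop p (k + 1) = k + 1 := by rw [lastStop, if_pos h]
      omega
    · have h' : lastStop p (k + 1) = lastStop p k := by rw [lastStop, if_neg h]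
      rw [h'] at hj ⊢
      rcases hk.lt_or_eq with h1 | h1
      · exact ih hj (by omega)
      · rwa [h1]

lemma exists_of_lastStop_eq {i j : ℕ} (hi : lastStop p i = i) (hj : lastStop p j = j)
    (hij : i < j) : ∃ l, i < l ∧ p i l := by
  by_contra! h
  have : ∀ l, i ≤ l → lastStop p l = i := by
    intro l hl
    induction l, hl using Nat.le_induction with
    | base => exact hi
    | succ l hl ih => rw [lastStop, ih, if_neg (h (l + 1) (by omega))]
  have := this j hij.le
  omega

lemma lastStop_congr {k : ℕ} (h : ∀ i j, i ≤ k → j ≤ k → (p i j ↔ q i j)) :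
    lastStop p k = lastStop q k := by
  induction k with
  | zero => rfl
  | succ k ih =>
    have ih' := ih fun i j hi hj => h i j (by omega) (by omega)
    have := h (lastStop q k) (k + 1) ((lastStop_le k).trans (by omega)) le_rfl
    rw [lastStop, lastStop, ih']
    by_cases hq : q (lastStop q k) (k + 1)
    · rw [if_pos hq, if_pos (this.2 hq)]
    · rw [if_neg hq, if_neg fun hp => hq (this.1 hp)]

open Classical in
/-- If the sums of `a` from each index to the next index stopped from there are bounded, then the
partial sums of `a` are bounded by the sum of these bounds over the stopping indices. -/
lemma abs_sum_le_sum_lastStop {a c : ℕ → ℝ}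
    (h : ∀ i j, i < j → (∀ l, i < l → l < j → ¬ p i l) → |∑ l ∈ Finset.Ico i j, a l| ≤ c i)
    (k : ℕ) :
    |∑ l ∈ Finset.range k, a l| ≤ ∑ i ∈ Finset.range k with lastStop p i = i, c i := by
  have hc : ∀ i, 0 ≤ c i := fun i =>
    (abs_nonneg _).trans (h i (i + 1) (Nat.lt_succ_self i) fun l h1 h2 => by omega)
  induction k using Nat.strong_induction_on with
  | _ k ih =>
    rcases Nat.eq_zero_or_pos k with rfl | hk
    · simp
    obtain ⟨m, rfl⟩ : ∃ m, k = m + 1 := ⟨k - 1, by omega⟩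
    set i := lastStop p m with hi
    have him : i ≤ m := lastStop_le m
    have h1 := ih i (by omega)
    have h2 := h i (m + 1) (by omega) fun l hl hl' => not_of_lastStop_lt hl (by omega)
    rw [← Finset.sum_range_add_sum_Ico a (show i ≤ m + 1 by omega)]
    refine (abs_add_le _ _).trans ((add_le_add h1 h2).trans ?_)
    have hnot : i ∉ (Finset.range i).filter fun i => lastStop p i = i := by simp
    rw [add_comm, ← Finset.sum_insert hnot]
    refine Finset.sum_le_sum_of_subset_of_nonneg ?_ fun j _ _ => hc j
    intro j hj
    simp only [Finset.mem_insert, Finset.mem_filter, Finset.mem_range] at hj ⊢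
    rcases hj with rfl | hj
    · exact ⟨by omega, lastStop_lastStop m⟩
    · exact ⟨by omega, hj.2⟩

/-- If there are only finitely many stopping indices, then nothing is stopped after the last. -/
lemma exists_forall_not_of_finite (h : {k | lastStop p k = k}.Finite) :
    ∃ i, ∀ l, i < l → ¬ p i l := by
  have h0 : {k | lastStop p k = k}.Nonempty := ⟨0, rfl⟩
  obtain ⟨i, hi, hmax⟩ := h.exists_maximal h0
  refine ⟨i, fun l hl => ?_⟩
  have h1 : lastStop p l = i := by
    refine le_antisymm ?_ ?_
    · by_contra hlt
      have := hmax (lastStop_lastStop l) (not_le.1 hlt).le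
      omega
    · have := lastStop_mono (p := p) hl.le
      rwa [show lastStop p i = i from hi] at this
  have := not_of_lastStop_lt (p := p) (j := l) (k := l) (by omega) le_rfl
  rwa [h1] at this

end LastStop

/-! ### From local stopping to sparse domination -/

section Principle

variable {n : ℕ} {D : DyadicGrid n}

lemma IsSparse.isCarleson {Λ : ℝ} (hΛ : 1 < Λ) {S : Set (DyadicCube n)}
    (hS : IsSparse Λ⁻¹ S) : IsCarleson D Λ S := by
  obtain ⟨E, hd, hE⟩ := hS
  have hΛ0 : 0 < Λ := by linarith
  intro Q _
  have h1 : ∀ P : {P : DyadicCube n // P ∈ S ∧ P.carrier ⊆ Q.carrier},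
      volume P.1.carrier ≤ ENNReal.ofReal Λ * volume (E P.1) := by
    intro P
    have h := (hE P.1 P.2.1).2.2
    calc volume P.1.carrier
        = ENNReal.ofReal Λ * (ENNReal.ofReal Λ⁻¹ * volume P.1.carrier) := by
          rw [← mul_assoc, ← ENNReal.ofReal_mul hΛ0.le, mul_inv_cancel₀ hΛ0.ne']; simp
      _ ≤ _ := by gcongr
  calc _ ≤ ∑' P : {P : DyadicCube n // P ∈ S ∧ P.carrier ⊆ Q.carrier},
        ENNReal.ofReal Λ * volume (E P.1) := ENNReal.tsum_le_tsum h1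
    _ = ENNReal.ofReal Λ * ∑' P : {P : DyadicCube n // P ∈ S ∧ P.carrier ⊆ Q.carrier},
        volume (E P.1) := ENNReal.tsum_mul_left
    _ ≤ ENNReal.ofReal Λ * volume Q.carrier := by
        gcongr
        refine (tsum_meas_le_meas_iUnion_of_disjoint volume
          (As := fun P : {P : DyadicCube n // P ∈ S ∧ P.carrier ⊆ Q.carrier} => E P.1)
          (fun P => (hE P.1 P.2.1).1) ?_).trans
          (measure_mono (iUnion_subset fun P => (hE P.1 P.2.1).2.1.trans P.2.2))
        intro P P' hne
        exact hd P.2.1 P'.2.1 fun h => hne (Subtype.ext h)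

/-- The stopping relation between the generations of cubes that descend from `Q₀` to `x`. -/
def stopRel (D : DyadicGrid n) (st : DyadicCube n → DyadicCube n → Prop) (Q₀ : DyadicCube n)
    (x : Fin n → ℝ) (i j : ℕ) : Prop :=
  st (D.descend Q₀ x i) (D.descend Q₀ x j)

/-- The principal cubes below `Q₀` for the stopping condition `st`: the cube `Q₀`, the maximal cubes
stopped from `Q₀`, the maximal cubes stopped from one of those, and so on. -/
def principalCubes (D : DyadicGrid n) (st : DyadicCube n → DyadicCube n → Prop)
    (Q₀ : DyadicCube n) : Set (DyadicCube n) :=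
  {Q | ∃ x ∈ Q₀.carrier, ∃ k, lastStop (stopRel D st Q₀ x) k = k ∧ Q = D.descend Q₀ x k}

variable {st : DyadicCube n → DyadicCube n → Prop} {Q₀ : DyadicCube n}

lemma descend_mem_subcubes (hn : 0 < n) (hQ₀ : Q₀ ∈ D.cubes) {x : Fin n → ℝ}
    (hx : x ∈ Q₀.carrier) (k : ℕ) : D.descend Q₀ x k ∈ D.subcubes Q₀ :=
  ⟨D.descend_mem _ _ _, DyadicGrid.descend_subset_self hn hQ₀ hx k⟩

lemma principalCubes_subset (hn : 0 < n) (hQ₀ : Q₀ ∈ D.cubes) :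
    principalCubes D st Q₀ ⊆ D.subcubes Q₀ := by
  rintro Q ⟨x, hx, k, -, rfl⟩
  exact descend_mem_subcubes hn hQ₀ hx k

lemma exists_lastStop_of_mem (hn : 0 < n) {Q : DyadicCube n} (hQ : Q ∈ principalCubes D st Q₀)
    {z : Fin n → ℝ} (hz : z ∈ Q.carrier) :
    ∃ k, lastStop (stopRel D st Q₀ z) k = k ∧ Q = D.descend Q₀ z k := by
  obtain ⟨x, hx, k, hk, rfl⟩ := hQ
  have hd : ∀ i ≤ k, D.descend Q₀ z i = D.descend Q₀ x i := fun i hi =>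
    DyadicGrid.descend_congr hn hz hi
  refine ⟨k, ?_, (hd k le_rfl).symm⟩
  rw [← hk]
  refine (congrArg _ hk).trans ((lastStop_congr fun i j hi hj => ?_))
  rw [stopRel, stopRel, hd i hi, hd j hj]

lemma isSparse_principalCubes (hn : 0 < n) (hQ₀ : Q₀ ∈ D.cubes) {Λ : ℝ}
    (hB : ∀ Q ∈ D.subcubes Q₀, volume (⋃ k, hitSet (st Q) (st Q) k Q) ≤
      ENNReal.ofReal ((1 - Λ⁻¹) * Q.vol)) (hΛ : 1 < Λ) :
    IsSparse Λ⁻¹ (principalCubes D st Q₀) := by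
  have key : ∀ z i j, i < j → lastStop (stopRel D st Q₀ z) i = i →
      lastStop (stopRel D st Q₀ z) j = j →
      z ∈ ⋃ k, hitSet (st (D.descend Q₀ z i)) (st (D.descend Q₀ z i)) k (D.descend Q₀ z i) := by
    intro z i j hij hi hj
    obtain ⟨l, hl, hp⟩ := exists_of_lastStop_eq hi hj hij
    refine mem_iUnion_hitSet hn (D.descend_mem _ _ _) (D.mem_descend _ _ _) (j := l - i) ?_
    rw [DyadicGrid.descend_descend, show i + (l - i) = l by omega]
    exact hp
  refine ⟨fun Q => Q.carrier \ ⋃ k, hitSet (st Q) (st Q) k Q, ?_, ?_⟩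
  · intro P hP Q hQ hne
    refine Set.disjoint_left.2 fun z hzP hzQ => ?_
    obtain ⟨i, hi, rfl⟩ := exists_lastStop_of_mem hn hP hzP.1
    obtain ⟨j, hj, rfl⟩ := exists_lastStop_of_mem hn hQ hzQ.1
    rcases lt_trichotomy i j with h | h | h
    · exact hzP.2 (key z i j h hi hj)
    · exact hne (by rw [h])
    · exact hzQ.2 (key z j i h hj hi)
  · intro Q hQ
    have hQ' := principalCubes_subset hn hQ₀ hQ
    have hm : MeasurableSet (⋃ k, hitSet (st Q) (st Q) k Q) :=
      MeasurableSet.iUnion fun k => measurableSet_hitSet k Q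
    have hs : (⋃ k, hitSet (st Q) (st Q) k Q) ⊆ Q.carrier :=
      iUnion_subset fun k => hitSet_subset k Q
    have hle := hB Q hQ'
    refine ⟨Q.measurableSet_carrier.diff hm, sdiff_subset, ?_⟩
    have hinv : 0 ≤ Λ⁻¹ := inv_nonneg.2 (by linarith)
    have hinv1 : Λ⁻¹ ≤ 1 := inv_le_one_of_one_le₀ hΛ.le
    rw [measure_sdiff hs hm.nullMeasurableSet (ne_top_of_le_ne_top ENNReal.ofReal_ne_top hle),
      Q.volume_eq_ofReal_vol, ← ENNReal.ofReal_mul hinv]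
    refine le_trans ?_ (tsub_le_tsub_left hle _)
    rw [← ENNReal.ofReal_sub _ (mul_nonneg (by linarith) Q.vol_pos.le)]
    exact ENNReal.ofReal_le_ofReal (by linarith)

/-- If for every cube `Q` below `Q₀` the maximal cubes stopped from `Q` cover at most the fraction
`1 - Λ⁻¹` of `Q`, if the partial sums of the terms from `Q` down to these cubes are at most `c Q`,
and if the series converges almost everywhere off these cubes, then the series is dominated by the
sum of `c Q` over a sparse collection. -/
theorem exists_sparse_domination (hn : 0 < n) (hQ₀ : Q₀ ∈ D.cubes) {Λ : ℝ} (hΛ : 1 < Λ)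
    {T : DyadicCube n → (Fin n → ℝ) → ℝ} {c : DyadicCube n → ℝ}
    (hB : ∀ Q ∈ D.subcubes Q₀, volume (⋃ k, hitSet (st Q) (st Q) k Q) ≤
      ENNReal.ofReal ((1 - Λ⁻¹) * Q.vol))
    (hF : ∀ Q ∈ D.subcubes Q₀, ∀ x ∈ Q.carrier, ∀ j,
      (∀ i, 0 < i → i < j → ¬ st Q (D.descend Q x i)) →
        |∑ i ∈ Finset.range j, T (D.descend Q x i) x| ≤ c Q)
    (hconv : ∀ Q ∈ D.subcubes Q₀, ∀ᵐ x, x ∈ Q.carrier →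
      (∀ i, 0 < i → ¬ st Q (D.descend Q x i)) →
        ∃ s, Tendsto (fun j => ∑ i ∈ Finset.range j, T (D.descend Q x i) x) atTop (𝓝 s)) :
    ∃ S ⊆ D.subcubes Q₀, IsCarleson D Λ S ∧ IsSparse Λ⁻¹ S ∧
      (∀ᵐ x ∂(volume.restrict Q₀.carrier),
        ∃ s, Tendsto (fun j => ∑ i ∈ Finset.range j, T (D.descend Q₀ x i) x) atTop (𝓝 s)) ∧
      ∀ x ∈ Q₀.carrier, ∀ k, ENNReal.ofReal |∑ i ∈ Finset.range k, T (D.descend Q₀ x i) x| ≤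
        ∑' Q : S, Q.1.carrier.indicator (fun _ => ENNReal.ofReal (c Q.1)) x := by
  classical
  have hsparse := isSparse_principalCubes hn hQ₀ hB hΛ
  have hsub := principalCubes_subset (st := st) hn hQ₀
  refine ⟨principalCubes D st Q₀, hsub, hsparse.isCarleson hΛ, hsparse, ?_, ?_⟩
  · -- almost every point lies in finitely many principal cubes
    have hfin : ∑' P : principalCubes D st Q₀, volume P.1.carrier ≠ ∞ := by
      have h := hsparse.isCarleson (D := D) hΛ Q₀ hQ₀
      have hle : ∑' P : principalCubes D st Q₀, volume P.1.carrier ≤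
          ENNReal.ofReal Λ * volume Q₀.carrier := by
        refine le_trans ?_ h
        exact ENNReal.tsum_comp_le_tsum_of_injective
          (f := fun P : principalCubes D st Q₀ =>
            (⟨P.1, P.2, (hsub P.2).2⟩ : {P // P ∈ principalCubes D st Q₀ ∧ P.carrier ⊆ Q₀.carrier}))
          (fun P P' h => Subtype.ext (congrArg (fun R => R.1) h))
          (fun P => volume P.1.carrier)
      exact ne_top_of_le_ne_top (ENNReal.mul_ne_top ENNReal.ofReal_ne_top Q₀.volume_ne_top) hle
    have : Countable (principalCubes D st Q₀) :=
      (DyadicGrid.countable_cubes.mono fun Q hQ => (hsub hQ).1).to_subtype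
    have h1 := ae_finite_setOfPred_mem hfin
    have h2 : ∀ᵐ x, ∀ Q ∈ D.subcubes Q₀, x ∈ Q.carrier →
        (∀ i, 0 < i → ¬ st Q (D.descend Q x i)) →
        ∃ s, Tendsto (fun j => ∑ i ∈ Finset.range j, T (D.descend Q x i) x) atTop (𝓝 s) :=
      (ae_ball_iff (DyadicGrid.countable_cubes.mono fun Q hQ => hQ.1)).2 hconv
    rw [ae_restrict_iff' Q₀.measurableSet_carrier]
    filter_upwards [h1, h2] with x hx1 hx2 hx
    have hfin' : {k | lastStop (stopRel D st Q₀ x) k = k}.Finite := by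
      refine Set.Finite.of_injOn (f := fun k => D.descend Q₀ x k)
        (t := Subtype.val '' {P : principalCubes D st Q₀ | x ∈ P.1.carrier}) ?_ ?_ (hx1.image _)
      · intro k hk
        exact ⟨⟨D.descend Q₀ x k, x, hx, k, hk, rfl⟩, D.mem_descend _ _ _, rfl⟩
      · intro k _ l _ hkl
        have := congrArg DyadicCube.scale hkl
        simp only [DyadicGrid.descend_scale] at this
        omega
    obtain ⟨i, hi⟩ := exists_forall_not_of_finite hfin'
    obtain ⟨s, hs⟩ := hx2 (D.descend Q₀ x i) (descend_mem_subcubes hn hQ₀ hx i)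
      (D.mem_descend _ _ _) (fun l hl => by
        rw [DyadicGrid.descend_descend]; exact hi (i + l) (by omega))
    refine ⟨∑ l ∈ Finset.range i, T (D.descend Q₀ x l) x + s, ?_⟩
    rw [← tendsto_add_atTop_iff_nat i]
    refine (hs.const_add _).congr fun j => ?_
    rw [add_comm j i, Finset.sum_range_add]
    simp only [DyadicGrid.descend_descend]
  · intro x hx k
    have h := abs_sum_le_sum_lastStop (p := stopRel D st Q₀ x)
      (a := fun l => T (D.descend Q₀ x l) x) (c := fun i => c (D.descend Q₀ x i)) (by
        intro i j hij hl
        have := hF (D.descend Q₀ x i) (descend_mem_subcubes hn hQ₀ hx i) x (D.mem_descend _ _ _)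
          (j - i) (fun l h0 h1 => by
            rw [DyadicGrid.descend_descend]; exact hl (i + l) (by omega) (by omega))
        rw [Finset.sum_Ico_eq_sum_range]
        simpa only [DyadicGrid.descend_descend] using this) k
    refine (ENNReal.ofReal_le_ofReal h).trans ?_
    set F := (Finset.range k).filter fun i => lastStop (stopRel D st Q₀ x) i = i with hFdef
    have hc : ∀ i, 0 ≤ c (D.descend Q₀ x i) := fun i => (abs_nonneg _).trans
      (hF _ (descend_mem_subcubes hn hQ₀ hx i) x (D.mem_descend _ _ _) 0 fun l _ h => by omega)
    rw [ENNReal.ofReal_sum_of_nonneg fun i _ => hc i]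
    let e : F → principalCubes D st Q₀ := fun i =>
      ⟨D.descend Q₀ x i, x, hx, i, (Finset.mem_filter.1 i.2).2, rfl⟩
    have he : Function.Injective e := by
      intro i j hij
      have := congrArg (fun Q : principalCubes D st Q₀ => Q.1.scale) hij
      simp only [e, DyadicGrid.descend_scale] at this
      exact Subtype.ext (by omega)
    refine le_trans ?_ (ENNReal.tsum_comp_le_tsum_of_injective he _)
    rw [tsum_fintype, ← Finset.sum_coe_sort F]
    refine Finset.sum_le_sum fun i _ => ?_
    rw [indicator_of_mem (D.mem_descend _ _ _)]

/-- At a point of `Q₀` the truncated sums are the partial sums over the descending cubes. -/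
lemma truncatedSum_eq (hn : 0 < n) (hQ₀ : Q₀ ∈ D.cubes) {T : DyadicCube n → (Fin n → ℝ) → ℝ}
    (hT : IsHaarLike T) {x : Fin n → ℝ} (hx : x ∈ Q₀.carrier) (m : ℤ) :
    truncatedSum D Q₀ T m x =
      ∑ i ∈ Finset.range (Q₀.scale - m + 1).toNat, T (D.descend Q₀ x i) x := by
  classical
  have hinj : Set.InjOn (fun i => D.descend Q₀ x i)
      (Finset.range (Q₀.scale - m + 1).toNat : Set ℕ) := by
    intro i _ j _ hij
    have := congrArg DyadicCube.scale hij
    simp only [DyadicGrid.descend_scale] at this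
    omega
  rw [← Finset.sum_image (f := fun Q => T Q x) hinj]
  refine finsum_mem_eq_sum_of_inter_support_eq (s := {Q | Q ∈ D.subcubes Q₀ ∧ m ≤ Q.scale})
    (fun Q => T Q x) ?_
  ext Q
  simp only [mem_inter_iff, mem_ofPred_eq, Function.mem_support, Finset.coe_image, mem_image,
    Finset.coe_range, mem_Iio]
  constructor
  · rintro ⟨⟨hQ, hm⟩, hne⟩
    have hxQ : x ∈ Q.carrier := by
      by_contra h; exact hne (hT.zero_of_notMem Q x h)
    have hle := DyadicCube.scale_le_of_subset hn hQ.2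
    exact ⟨⟨_, by omega, (DyadicGrid.eq_descend hn hQ.1 hQ.2 hxQ).symm⟩, hne⟩
  · rintro ⟨⟨i, hi, rfl⟩, hne⟩
    exact ⟨⟨descend_mem_subcubes hn hQ₀ hx i, by simp; omega⟩, hne⟩

lemma tendsto_scale_toNat (k : ℤ) : Tendsto (fun m : ℤ => (k - m + 1).toNat) atBot atTop := by
  refine tendsto_atTop.2 fun b => ?_
  filter_upwards [eventually_le_atBot (k - b)] with m hm
  omega

/-- Sparse domination follows from its form for the partial sums over descending cubes. -/
lemma sparselyDominated_of_partialSums (hn : 0 < n) (hQ₀ : Q₀ ∈ D.cubes) {Λ : ℝ} {K : ℝ≥0∞}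
    {w f : (Fin n → ℝ) → ℝ} {T : DyadicCube n → (Fin n → ℝ) → ℝ} (hT : IsHaarLike T)
    {S : Set (DyadicCube n)} (hS : S ⊆ D.subcubes Q₀) (hC : IsCarleson D Λ S)
    (hsp : IsSparse Λ⁻¹ S)
    (hconv : ∀ᵐ x ∂(volume.restrict Q₀.carrier),
      ∃ s, Tendsto (fun j => ∑ i ∈ Finset.range j, T (D.descend Q₀ x i) x) atTop (𝓝 s))
    (hle : ∀ x ∈ Q₀.carrier, ∀ k,
      ‖∑ i ∈ Finset.range k, T (D.descend Q₀ x i) x‖ₑ ≤ K * sparseOp w S f x) :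
    SparselyDominated D Q₀ Λ K w f T := by
  have htr : ∀ x ∈ Q₀.carrier, ∀ m, ‖truncatedSum D Q₀ T m x‖ₑ ≤ K * sparseOp w S f x := by
    intro x hx m
    rw [truncatedSum_eq hn hQ₀ hT hx]
    exact hle x hx _
  refine ⟨S, hS, hC, hsp, ?_, ?_, htr⟩
  · rw [ae_restrict_iff' Q₀.measurableSet_carrier] at hconv ⊢
    filter_upwards [hconv] with x h hx
    obtain ⟨s, hs⟩ := h hx
    refine ⟨s, ?_⟩
    simp only [SumsTo, truncatedSum_eq hn hQ₀ hT hx]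
    exact hs.comp (tendsto_scale_toNat _)
  · intro x hx s hs
    exact le_of_tendsto hs.enorm (Eventually.of_forall fun m => htr x hx m)

end Principle

/-! ### Haar functions and Haar coefficients -/

section Haar

variable {n : ℕ}

/-- The sign of the Haar function with signature `ε` on the child with address `σ`. -/
def haarSign (ε σ : Fin n → Bool) : ℝ := ∏ i, if ε i || σ i then 1 else -1

lemma abs_haarSign (ε σ : Fin n → Bool) : |haarSign ε σ| = 1 := by
  rw [haarSign, Finset.abs_prod]
  exact Finset.prod_eq_one fun i _ => by split_ifs <;> simp

lemma haarSign_sq (ε σ : Fin n → Bool) : haarSign ε σ ^ 2 = 1 := by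
  rw [← sq_abs, abs_haarSign, one_pow]

lemma sum_haarSign {ε : Fin n → Bool} (hε : ε ∈ cancellative n) : ∑ σ, haarSign ε σ = 0 := by
  simp only [haarSign]
  rw [← Fintype.prod_sum (fun i (s : Bool) => if ε i || s then (1 : ℝ) else -1)]
  obtain ⟨i, hi⟩ : ∃ i, ε i = false := by
    by_contra! h
    exact (Finset.mem_filter.1 hε).2 (funext fun i => by simpa using h i)
  exact Finset.prod_eq_zero (Finset.mem_univ i) (by simp [hi])

lemma haarOne_eq {a l t : ℝ} (e s : Bool) (hl : 0 < l)
    (h : a + (if s then l / 2 else 0) ≤ t ∧ t < a + (if s then l else l / 2)) :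
    haarOne a l e t = (√l)⁻¹ * if e || s then 1 else -1 := by
  cases e <;> cases s <;>
    simp only [if_true, Bool.false_eq_true, if_false, add_zero] at h <;>
    simp only [haarOne, Bool.or_true, Bool.or_false, if_true, Bool.false_eq_true, if_false] <;>
    congr 1
  · rw [indicator_of_notMem (by simp [h.2]), indicator_of_mem (by exact h)]; simp
  · rw [indicator_of_mem (by exact h), indicator_of_notMem (by simp [h.1])]; simp
  · exact indicator_of_mem (by exact ⟨h.1, by linarith⟩) _
  · exact indicator_of_mem (by exact ⟨by linarith, h.2⟩) _

lemma haarOne_eq_zero {a l t : ℝ} (e : Bool) (hl : 0 < l) (h : t ∉ Ico a (a + l)) :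
    haarOne a l e t = 0 := by
  cases e
  · simp only [haarOne]
    rw [indicator_of_notMem fun h' => h ⟨by linarith [h'.1], h'.2⟩,
      indicator_of_notMem fun h' => h ⟨h'.1, by linarith [h'.2]⟩]
    simp
  · simp [haarOne, indicator_of_notMem h]

lemma haar_eq_of_mem_child {Q : DyadicCube n} {σ : Fin n → Bool} {x : Fin n → ℝ}
    (hx : x ∈ (Q.child σ).carrier) (ε : Fin n → Bool) :
    haar Q ε x = (√Q.vol)⁻¹ * haarSign ε σ := by
  have h := DyadicCube.mem_child.1 hx
  rw [haar, haarSign, Finset.prod_congr rfl fun i _ => haarOne_eq (ε i) (σ i) Q.side_pos (h i),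
    Finset.prod_mul_distrib]
  congr 1
  rw [DyadicCube.vol_eq, Finset.prod_const, Finset.card_univ, Fintype.card_fin, inv_pow]
  congr 1
  refine (Real.sqrt_eq_iff_mul_self_eq (pow_nonneg Q.side_pos.le n) (by positivity)).2 ?_ |>.symm
  rw [← mul_pow, Real.mul_self_sqrt Q.side_pos.le]

lemma haar_eq_zero {Q : DyadicCube n} {x : Fin n → ℝ} (hx : x ∉ Q.carrier) (ε : Fin n → Bool) :
    haar Q ε x = 0 := by
  obtain ⟨i, hi⟩ := not_forall.1 hx
  exact Finset.prod_eq_zero (Finset.mem_univ i) (haarOne_eq_zero _ Q.side_pos hi)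

lemma abs_haar_le (Q : DyadicCube n) (ε : Fin n → Bool) (x : Fin n → ℝ) :
    |haar Q ε x| ≤ (√Q.vol)⁻¹ := by
  have h0 : 0 ≤ (√Q.vol)⁻¹ := inv_nonneg.2 (Real.sqrt_nonneg _)
  by_cases hx : x ∈ Q.carrier
  · rw [haar_eq_of_mem_child (DyadicCube.mem_child_childAddress hx), abs_mul, abs_haarSign,
      mul_one, abs_of_nonneg h0]
  · rw [haar_eq_zero hx, abs_zero]; exact h0

lemma inv_sqrt_vol_mul_self (Q : DyadicCube n) : (√Q.vol)⁻¹ * (√Q.vol)⁻¹ = Q.vol⁻¹ := by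
  rw [← mul_inv, Real.mul_self_sqrt Q.vol_pos.le]

lemma haarCoeff_eq {Q : DyadicCube n} {g : (Fin n → ℝ) → ℝ} (hg : IntegrableOn g Q.carrier volume)
    (ε : Fin n → Bool) :
    haarCoeff g Q ε = (√Q.vol)⁻¹ * ∑ σ, haarSign ε σ * ∫ x in (Q.child σ).carrier, g x := by
  have heq : ∀ σ, EqOn (fun x => g x * haar Q ε x)
      (fun x => ((√Q.vol)⁻¹ * haarSign ε σ) * g x) (Q.child σ).carrier := by
    intro σ x hx
    simp only [haar_eq_of_mem_child hx]
    ring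
  have hint : ∀ σ, IntegrableOn (fun x => g x * haar Q ε x) (Q.child σ).carrier volume := by
    intro σ
    refine IntegrableOn.congr_fun ?_ (heq σ).symm (Q.child σ).measurableSet_carrier
    exact (hg.mono_set (Q.child_subset σ)).const_mul _
  rw [haarCoeff, ← setIntegral_eq_integral_of_forall_compl_eq_zero (s := Q.carrier)
    (fun x hx => by rw [haar_eq_zero hx, mul_zero]), ← Q.iUnion_child,
    integral_iUnion_fintype (fun σ => (Q.child σ).measurableSet_carrier) Q.child_disjoint hint,
    Finset.mul_sum]
  refine Finset.sum_congr rfl fun σ _ => ?_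
  rw [setIntegral_congr_fun (Q.child σ).measurableSet_carrier (heq σ), integral_const_mul]
  ring

/-- Cancellative Haar coefficients do not see constants. -/
lemma haarCoeff_sub_const {Q : DyadicCube n} {g : (Fin n → ℝ) → ℝ}
    (hg : IntegrableOn g Q.carrier volume) {ε : Fin n → Bool} (hε : ε ∈ cancellative n) (c : ℝ) :
    haarCoeff (fun x => g x - c) Q ε = haarCoeff g Q ε := by
  have hc : ∀ P : DyadicCube n, IntegrableOn (fun _ => c) P.carrier volume :=
    fun P => integrableOn_const P.volume_ne_top
  have h : ∀ σ, ∫ x in (Q.child σ).carrier, (g x - c) =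
      (∫ x in (Q.child σ).carrier, g x) - Q.vol / 2 ^ n * c := by
    intro σ
    rw [integral_sub (hg.mono_set (Q.child_subset σ)) (hc _), setIntegral_const, smul_eq_mul,
      ← Q.child_vol σ]
    rfl
  rw [haarCoeff_eq hg, haarCoeff_eq (g := fun x => g x - c) (hg.sub (hc Q))]
  simp only [h, mul_sub, Finset.sum_sub_distrib, ← Finset.sum_mul, sum_haarSign hε, zero_mul,
    sub_zero]

lemma abs_haarCoeff_le {Q : DyadicCube n} {g : (Fin n → ℝ) → ℝ}
    (hg : IntegrableOn g Q.carrier volume) (ε : Fin n → Bool) :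
    |haarCoeff g Q ε| ≤ (√Q.vol)⁻¹ * ∫ x in Q.carrier, |g x| := by
  rw [haarCoeff_eq hg, abs_mul, abs_of_nonneg (inv_nonneg.2 (Real.sqrt_nonneg _)),
    DyadicCube.integral_eq_sum_child hg.abs]
  gcongr
  refine (Finset.abs_sum_le_sum_abs _ _).trans (Finset.sum_le_sum fun σ _ => ?_)
  rw [abs_mul, abs_haarSign, one_mul]
  exact abs_integral_le_integral_abs

lemma card_cancellative_le : ((cancellative n).card : ℝ) ≤ 2 ^ n := by
  have h : (cancellative n).card ≤ 2 ^ n := by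
    refine (Finset.card_filter_le _ _).trans ?_
    simp
  exact_mod_cast h

/-- The quantity `|R| ⟨g⟩_R²`, whose increments over trees control the Haar coefficients. -/
def avgEnergy (g : (Fin n → ℝ) → ℝ) (R : DyadicCube n) : ℝ :=
  (∫ x in R.carrier, g x) ^ 2 / R.vol

/-- The sum of the squares of the cancellative Haar coefficients over one cube. -/
def coeffEnergy (g : (Fin n → ℝ) → ℝ) (R : DyadicCube n) : ℝ :=
  ∑ ε ∈ cancellative n, haarCoeff g R ε ^ 2

lemma haarCoeff_sq_le {R : DyadicCube n} {g : (Fin n → ℝ) → ℝ}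
    (hg : IntegrableOn g R.carrier volume) {ε : Fin n → Bool} (hε : ε ∈ cancellative n) :
    haarCoeff g R ε ^ 2 ≤ ∑ σ, avgEnergy g (R.child σ) - avgEnergy g R := by
  have hv := R.vol_pos
  set I : (Fin n → Bool) → ℝ := fun σ => ∫ x in (R.child σ).carrier, g x with hI
  set u : ℝ := (∑ σ, I σ) / 2 ^ n with hu
  have hN : (0 : ℝ) < 2 ^ n := by positivity
  have h1 : ∑ σ, haarSign ε σ * I σ = ∑ σ, haarSign ε σ * (I σ - u) := by
    simp only [mul_sub, Finset.sum_sub_distrib, ← Finset.sum_mul, sum_haarSign hε, zero_mul,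
      sub_zero]
  have h2 : (∑ σ, haarSign ε σ * (I σ - u)) ^ 2 ≤ 2 ^ n * ∑ σ, (I σ - u) ^ 2 := by
    refine (Finset.sum_mul_sq_le_sq_mul_sq _ _ _).trans_eq ?_
    simp [haarSign_sq]
  have h3 : ∑ σ, (I σ - u) ^ 2 = ∑ σ, I σ ^ 2 - (∑ σ, I σ) ^ 2 / 2 ^ n := by
    have : ∀ σ, (I σ - u) ^ 2 = I σ ^ 2 - 2 * u * I σ + u ^ 2 := fun σ => by ring
    simp only [this, Finset.sum_add_distrib, Finset.sum_sub_distrib, ← Finset.mul_sum,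
      Finset.sum_const, Finset.card_univ, Fintype.card_fun, Fintype.card_bool, Fintype.card_fin,
      nsmul_eq_mul]
    rw [show ∑ σ, I σ = 2 ^ n * u by rw [hu, mul_div_cancel₀ _ hN.ne']]
    push_cast
    field_simp
    ring
  have h4 : ∑ σ, avgEnergy g (R.child σ) - avgEnergy g R =
      R.vol⁻¹ * (2 ^ n * ∑ σ, (I σ - u) ^ 2) := by
    rw [h3]
    simp only [avgEnergy, R.child_vol, DyadicCube.integral_eq_sum_child hg, ← Finset.sum_div, hI]
    field_simp
  rw [h4, haarCoeff_eq hg, mul_pow, h1, sq, inv_sqrt_vol_mul_self]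
  gcongr

lemma coeffEnergy_le {R : DyadicCube n} {g : (Fin n → ℝ) → ℝ}
    (hg : IntegrableOn g R.carrier volume) :
    coeffEnergy g R ≤ 2 ^ n * (∑ σ, avgEnergy g (R.child σ) - avgEnergy g R) := by
  have h := Finset.sum_le_card_nsmul (cancellative n) (fun ε => haarCoeff g R ε ^ 2) _
    fun ε hε => haarCoeff_sq_le hg hε
  refine h.trans ?_
  rw [nsmul_eq_mul]
  rcases (cancellative n).eq_empty_or_nonempty with he | ⟨ε, hε⟩
  · have h0 : 0 ≤ ∑ σ, avgEnergy g (R.child σ) - avgEnergy g R := by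
      -- with no cancellative signature the cube has just one child
      have hn : n = 0 := by
        by_contra hn
        have : (fun _ => false) ∈ cancellative n :=
          Finset.mem_filter.2 ⟨Finset.mem_univ _, fun h' => by
            simpa using congrFun h' ⟨0, Nat.pos_of_ne_zero hn⟩⟩
        simp [he] at this
      subst hn
      simp [avgEnergy, DyadicCube.child_vol, DyadicCube.integral_eq_sum_child hg]
    simp only [he, Finset.card_empty, Nat.cast_zero, zero_mul]
    positivity
  · exact mul_le_mul_of_nonneg_right card_cancellative_le
      ((sq_nonneg _).trans (haarCoeff_sq_le hg hε))

/-- The `L²` bound for the good part of the Calderón–Zygmund decomposition: the Haar coefficients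
of `g` over the cubes above the stopping cubes, where the averages of `|g|` are at most `a * m`. -/
lemma nodeSum_coeffEnergy_le {st : DyadicCube n → Prop} {Q : DyadicCube n} {g : (Fin n → ℝ) → ℝ}
    (hg : IntegrableOn g Q.carrier volume) {a m : ℝ} (ha : 1 ≤ a) (hm : 0 ≤ m)
    (hQ : ∫ x in Q.carrier, |g x| ≤ m * Q.vol)
    (hst : ∀ R, ¬ st R → ∫ x in R.carrier, |g x| ≤ a * m * R.vol) (k : ℕ) :
    nodeSum st (coeffEnergy g) k Q ≤ 4 ^ n * a * m ^ 2 * Q.vol := by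
  set M : ℝ := 2 ^ n * a * m with hM
  have hM0 : 0 ≤ M := by positivity
  let I : DyadicCube n → Prop := fun R =>
    IntegrableOn g R.carrier volume ∧ ∫ x in R.carrier, |g x| ≤ M * R.vol
  have hI : ∀ R, I R → ¬ st R → ∀ σ, I (R.child σ) := by
    intro R hR hs σ
    refine ⟨hR.1.mono_set (R.child_subset σ), ?_⟩
    refine (setIntegral_mono_set hR.1.abs (Eventually.of_forall fun _ => abs_nonneg _)
      (R.child_subset σ).eventuallyLE).trans ((hst R hs).trans_eq ?_)
    rw [R.child_vol, hM]
    field_simp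
  have h1 : (1 : ℝ) ≤ 2 ^ n := one_le_pow₀ one_le_two
  have hIQ : I Q := by
    refine ⟨hg, hQ.trans ?_⟩
    have : m ≤ M := by
      have : 1 * 1 * m ≤ 2 ^ n * a * m := by gcongr
      linarith
    exact mul_le_mul_of_nonneg_right this Q.vol_pos.le
  have h2 : leafSum st (avgEnergy g) k Q ≤ M * (m * Q.vol) := by
    calc leafSum st (avgEnergy g) k Q
        ≤ leafSum st (fun R => M * ∫ x in R.carrier, |g x|) k Q := by
          refine leafSum_mono hI (fun R hR => ?_) hIQ
          rw [avgEnergy, div_le_iff₀ R.vol_pos, ← sq_abs]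
          have h3 : |∫ x in R.carrier, g x| ≤ ∫ x in R.carrier, |g x| :=
            abs_integral_le_integral_abs
          have h4 : 0 ≤ ∫ x in R.carrier, |g x| := (abs_nonneg _).trans h3
          calc |∫ x in R.carrier, g x| ^ 2 ≤ (∫ x in R.carrier, |g x|) ^ 2 := by gcongr
            _ = (∫ x in R.carrier, |g x|) * ∫ x in R.carrier, |g x| := sq _
            _ ≤ (M * R.vol) * ∫ x in R.carrier, |g x| := by
              gcongr
              exact hR.2
            _ = _ := by ring
      _ = M * ∫ x in Q.carrier, |g x| := by
          rw [leafSum_const_mul, leafSum_integral k hg.abs]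
      _ ≤ _ := by gcongr
  have h3 : nodeSum st (coeffEnergy g) k Q ≤
      2 ^ n * nodeSum st (fun R => ∑ σ, avgEnergy g (R.child σ) - avgEnergy g R) k Q := by
    rw [← nodeSum_const_mul]
    exact nodeSum_mono hI (fun R hR _ => coeffEnergy_le hR.1) hIQ
  have h4 := leafSum_eq (st := st) (φ := avgEnergy g) k Q
  have h5 : 0 ≤ avgEnergy g Q := div_nonneg (sq_nonneg _) Q.vol_pos.le
  calc nodeSum st (coeffEnergy g) k Q
      ≤ 2 ^ n * (M * (m * Q.vol)) := h3.trans (by gcongr; linarith)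
    _ = 4 ^ n * a * m ^ 2 * Q.vol := by
        rw [hM, show (4 : ℝ) = 2 * 2 by norm_num, mul_pow]; ring

end Haar

/-! ### Almost everywhere convergence of square-summable Haar-like series -/

section Convergence

variable {n : ℕ} {D : DyadicGrid n} {T : DyadicCube n → (Fin n → ℝ) → ℝ}

/-- The integral of the square of a Haar-like term. -/
def termEnergy (T : DyadicCube n → (Fin n → ℝ) → ℝ) (R : DyadicCube n) : ℝ :=
  ∑ σ, (R.child σ).vol * T R (R.child σ).corner ^ 2

lemma termEnergy_nonneg (R : DyadicCube n) : 0 ≤ termEnergy T R :=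
  Finset.sum_nonneg fun σ _ => mul_nonneg (R.child σ).vol_pos.le (sq_nonneg _)

lemma subcubes_child (hn : 0 < n) {Q R : DyadicCube n} (hR : R ∈ D.subcubes Q)
    (σ : Fin n → Bool) : R.child σ ∈ D.subcubes Q :=
  ⟨DyadicGrid.child_mem hn hR.1 σ, (R.child_subset σ).trans hR.2⟩

/-- Orthogonality: if the terms have mean zero, the `L²` norm of a sum over the nodes of a tree is
the sum of the `L²` norms. -/
lemma leafSum_sumAbove_sq_le (hn : 0 < n) (hT : IsHaarLike T)
    (h0 : ∀ R, ∑ σ, T R (DyadicCube.child R σ).corner = 0) {Q : DyadicCube n} (hQ : Q ∈ D.cubes)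
    (st : DyadicCube n → Prop) (k : ℕ) :
    leafSum st (fun R => R.vol * sumAbove D T Q R ^ 2) k Q ≤ nodeSum st (termEnergy T) k Q := by
  rw [leafSum_eq, sumAbove_self]
  simp only [ne_eq, OfNat.ofNat_ne_zero, not_false_eq_true, zero_pow, mul_zero, zero_add]
  refine nodeSum_mono (I := fun R => R ∈ D.subcubes Q)
    (fun R hR _ σ => subcubes_child hn hR σ) (fun R hR _ => le_of_eq ?_) ⟨hQ, Subset.rfl⟩
  set F := sumAbove D T Q R
  have h : ∀ σ, (R.child σ).vol * sumAbove D T Q (R.child σ) ^ 2 =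
      (R.child σ).vol * F ^ 2 + 2 * F * (R.vol / 2 ^ n) * T R (R.child σ).corner +
        (R.child σ).vol * T R (R.child σ).corner ^ 2 := by
    intro σ
    rw [sumAbove_child hT hn hR.1 hR.2, R.child_vol]
    ring
  simp only [h, Finset.sum_add_distrib, ← Finset.mul_sum, ← Finset.sum_mul, h0, R.sum_child_vol,
    termEnergy]
  ring

/-- The terms of the cubes of side length at most `2 ^ c`. -/
def cutTerm (c : ℤ) (T : DyadicCube n → (Fin n → ℝ) → ℝ) (Q : DyadicCube n) (x : Fin n → ℝ) : ℝ :=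
  if Q.scale ≤ c then T Q x else 0

lemma IsHaarLike.cutTerm (hT : IsHaarLike T) (c : ℤ) : IsHaarLike (cutTerm c T) where
  zero_of_notMem Q x hx := by simp [_root_.cutTerm, hT.zero_of_notMem Q x hx]
  const_child Q σ x y hx hy := by simp only [_root_.cutTerm, hT.const_child Q σ x y hx hy]

lemma termEnergy_cutTerm (c : ℤ) :
    termEnergy (cutTerm c T) = fun R => if R.scale ≤ c then termEnergy T R else 0 := by
  funext R
  by_cases h : R.scale ≤ c <;> simp [termEnergy, cutTerm, h]

lemma sum_cutTerm (Q : DyadicCube n) (x : Fin n → ℝ) {K j : ℕ} (h : K ≤ j) :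
    ∑ i ∈ Finset.range j, cutTerm (Q.scale - K) T (D.descend Q x i) x =
      ∑ i ∈ Finset.range j, T (D.descend Q x i) x - ∑ i ∈ Finset.range K, T (D.descend Q x i) x := by
  rw [← Finset.sum_Ico_eq_sub _ h, ← Finset.sum_range_add_sum_Ico _ h,
    Finset.sum_eq_zero (s := Finset.range K), zero_add]
  · refine Finset.sum_congr rfl fun i hi => ?_
    have := (Finset.mem_Ico.1 hi).1
    simp only [cutTerm, DyadicGrid.descend_scale]
    rw [if_pos (by omega)]
  · intro i hi
    have := Finset.mem_range.1 hi
    simp only [cutTerm, DyadicGrid.descend_scale]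
    rw [if_neg (by omega)]

/-- The weak type estimate for the tails of the series. -/
lemma volume_tail_le (hn : 0 < n) (hT : IsHaarLike T)
    (h0 : ∀ R, ∑ σ, T R (DyadicCube.child R σ).corner = 0) {Q : DyadicCube n} (hQ : Q ∈ D.cubes)
    {st : DyadicCube n → Prop} {K : ℕ} {η δ : ℝ} (hδ : 0 < δ)
    (hK : ∀ k, nodeSum st (termEnergy T) k Q ≤ nodeSum st (termEnergy T) K Q + η) :
    volume {x | x ∈ Q.carrier ∧ (∀ i, ¬ st (D.descend Q x i)) ∧
      ∃ j, δ < |∑ i ∈ Finset.range j, cutTerm (Q.scale - K) T (D.descend Q x i) x|} ≤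
      ENNReal.ofReal ((δ ^ 2)⁻¹ * η) := by
  classical
  set T' := cutTerm (Q.scale - K) T with hT'
  have hT'H : IsHaarLike T' := hT.cutTerm _
  have h0' : ∀ R, ∑ σ, T' R (DyadicCube.child R σ).corner = 0 := by
    intro R
    by_cases h : R.scale ≤ Q.scale - K <;> simp [hT', cutTerm, h, h0]
  let hit : DyadicCube n → Prop := fun R => δ < |sumAbove D T' Q R|
  let st' : DyadicCube n → Prop := fun R => st R ∨ hit R
  have hbound : ∀ k, leafSum st' (fun R => (δ ^ 2)⁻¹ * (R.vol * sumAbove D T' Q R ^ 2)) k Q ≤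
      (δ ^ 2)⁻¹ * η := by
    intro k
    rw [leafSum_const_mul]
    gcongr
    have h1 := leafSum_sumAbove_sq_le hn hT'H h0' hQ st' k
    have h2 := nodeSum_anti (st := st) (st' := st') (fun R h => Or.inl h)
      (termEnergy_nonneg (T := T')) k Q
    have h3 : nodeSum st (termEnergy T') k Q ≤ nodeSum st (termEnergy T') (max k K) Q :=
      nodeSum_mono_depth termEnergy_nonneg Q (le_max_left k K)
    have h4 := nodeSum_cut (st := st) (ψ := termEnergy T) (c := Q.scale - K) (le_max_right k K)
      (R := Q) (by ring)
    rw [← termEnergy_cutTerm] at h4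
    linarith [hK (max k K)]
  refine (measure_mono ?_).trans (volume_iUnion_hitSet_le (st := st') (hit := hit)
    (I := fun R => R ∈ D.subcubes Q) (fun R h => Or.inr h)
    (fun R hR _ σ => subcubes_child hn hR σ)
    (fun R _ => mul_nonneg (by positivity) (mul_nonneg R.vol_pos.le (sq_nonneg _)))
    (fun R _ hR => ?_) ⟨hQ, Subset.rfl⟩ hbound)
  · rintro x ⟨hx, hs, hj⟩
    have hj' : ∃ j, hit (D.descend Q x j) := by
      obtain ⟨j, hj⟩ := hj
      exact ⟨j, by simpa only [hit, sumAbove_descend hT'H hn] using hj⟩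
    refine mem_iUnion.2 ⟨Nat.find hj', mem_hitSet hn hQ hx (Nat.find_spec hj') fun i hi h => ?_⟩
    exact h.elim (hs i) (Nat.find_min hj' hi)
  · have h1 : δ ^ 2 ≤ sumAbove D T' Q R ^ 2 := by
      rw [← sq_abs (sumAbove D T' Q R)]
      exact pow_le_pow_left₀ hδ.le (le_of_lt hR) 2
    rw [mul_left_comm]
    refine le_mul_of_one_le_right R.vol_pos.le ?_
    rw [inv_mul_eq_div, one_le_div (by positivity)]
    exact h1

/-- The series converges at almost every point all of whose cubes are nodes, if the sum over the
nodes of the energies is finite. -/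
lemma ae_tendsto_of_nodeSum_le (hn : 0 < n) (hT : IsHaarLike T)
    (h0 : ∀ R, ∑ σ, T R (DyadicCube.child R σ).corner = 0) {Q : DyadicCube n} (hQ : Q ∈ D.cubes)
    {st : DyadicCube n → Prop} {V : ℝ} (hV : ∀ k, nodeSum st (termEnergy T) k Q ≤ V) :
    ∀ᵐ x, x ∈ Q.carrier → (∀ i, ¬ st (D.descend Q x i)) →
      ∃ s, Tendsto (fun j => ∑ i ∈ Finset.range j, T (D.descend Q x i) x) atTop (𝓝 s) := by
  have hmono := nodeSum_mono_depth (st := st) (termEnergy_nonneg (T := T)) Q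
  have hlim := tendsto_atTop_ciSup hmono ⟨V, by rintro _ ⟨k, rfl⟩; exact hV k⟩
  have hK : ∀ η : ℝ, 0 < η → ∃ K, ∀ k,
      nodeSum st (termEnergy T) k Q ≤ nodeSum st (termEnergy T) K Q + η := by
    intro η hη
    obtain ⟨K, hK⟩ := ((tendsto_order.1 hlim).1 _ (sub_lt_self _ hη)).exists
    refine ⟨K, fun k => ?_⟩
    have := hmono.ge_of_tendsto hlim k
    linarith
  have hnull : ∀ p : ℕ, ∀ᵐ x, x ∈ Q.carrier → (∀ i, ¬ st (D.descend Q x i)) → ∃ K : ℕ, ∀ j,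
      |∑ i ∈ Finset.range j, cutTerm (Q.scale - K) T (D.descend Q x i) x| ≤ 1 / ((p : ℝ) + 1) := by
    intro p
    have hδ : (0 : ℝ) < 1 / ((p : ℝ) + 1) := Nat.one_div_pos_of_nat
    set δ : ℝ := 1 / ((p : ℝ) + 1)
    rw [ae_iff]
    refine le_antisymm (ENNReal.le_of_forall_pos_le_add fun ε hε _ => ?_) bot_le
    obtain ⟨K, hK⟩ := hK (δ ^ 2 * ε) (by positivity)
    refine (measure_mono ?_).trans ((volume_tail_le hn hT h0 hQ hδ hK).trans ?_)
    · intro x hx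
      simp only [mem_ofPred_eq, Classical.not_imp, not_exists, not_forall, not_le] at hx
      exact ⟨hx.1, hx.2.1, hx.2.2 K⟩
    · rw [inv_mul_cancel_left₀ (by positivity), zero_add, ENNReal.ofReal_coe_nnreal]
  filter_upwards [ae_all_iff.2 hnull] with x hx hxQ hs
  refine cauchySeq_tendsto_of_complete (Metric.cauchySeq_iff'.2 fun ε hε => ?_)
  obtain ⟨p, hp⟩ := exists_nat_one_div_lt hε
  obtain ⟨K, hK⟩ := hx p hxQ hs
  refine ⟨K, fun j hj => ?_⟩
  have := hK j
  rw [sum_cutTerm Q x hj] at this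
  rw [Real.dist_eq]
  exact this.trans_lt hp

end Convergence

/-! ### Local estimates on a stopping tree -/

section LocalEstimates

variable {n : ℕ} {D : DyadicGrid n}

/-- The stopping condition `st` below the cube `Q` bounds the averages of `|f|` by `a * mf` and
those of `|b - c|` by `a * mb`, where `mf` and `mb` bound the averages over `Q` itself. -/
structure StoppingData (b f : (Fin n → ℝ) → ℝ) (c a mf mb : ℝ) (st : DyadicCube n → Prop)
    (Q : DyadicCube n) : Prop where
  integrable_b : IntegrableOn b Q.carrier volume
  integrable_f : IntegrableOn f Q.carrier volume
  one_le : 1 ≤ a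
  mf_nonneg : 0 ≤ mf
  mb_nonneg : 0 ≤ mb
  root_f : ∫ x in Q.carrier, |f x| ≤ mf * Q.vol
  root_b : ∫ x in Q.carrier, |b x - c| ≤ mb * Q.vol
  avg_f : ∀ R, ¬ st R → ∫ x in R.carrier, |f x| ≤ a * mf * R.vol
  avg_b : ∀ R, ¬ st R → ∫ x in R.carrier, |b x - c| ≤ a * mb * R.vol

variable {b f : (Fin n → ℝ) → ℝ} {c a mf mb : ℝ} {st : DyadicCube n → Prop} {Q R : DyadicCube n}

lemma integrableOn_sub_const (hb : IntegrableOn b R.carrier volume) (c : ℝ) :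
    IntegrableOn (fun x => b x - c) R.carrier volume :=
  Integrable.sub hb (integrableOn_const (μ := volume) (C := c) R.volume_ne_top)

lemma cubeAvg_eq (g : (Fin n → ℝ) → ℝ) (R : DyadicCube n) :
    cubeAvg g R = R.vol⁻¹ * ∫ x in R.carrier, g x := by
  rw [cubeAvg, setAverage_eq, smul_eq_mul]; rfl

lemma cubeAvg_mul_vol (g : (Fin n → ℝ) → ℝ) (R : DyadicCube n) :
    cubeAvg g R * R.vol = ∫ x in R.carrier, g x := by
  rw [cubeAvg_eq, mul_right_comm, inv_mul_cancel₀ R.vol_pos.ne', one_mul]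

lemma abs_cubeAvg_le (h : ∫ x in R.carrier, |f x| ≤ a * mf * R.vol) : |cubeAvg f R| ≤ a * mf := by
  have hv := R.vol_pos
  rw [cubeAvg_eq, abs_mul, abs_of_pos (inv_pos.2 hv), inv_mul_le_iff₀ hv, mul_comm R.vol]
  exact abs_integral_le_integral_abs.trans h

lemma coeffEnergy_sub_const (hb : IntegrableOn b R.carrier volume) (c : ℝ) :
    coeffEnergy (fun x => b x - c) R = coeffEnergy b R :=
  Finset.sum_congr rfl fun _ hε => by rw [haarCoeff_sub_const hb hε]

lemma coeffEnergy_nonneg (g : (Fin n → ℝ) → ℝ) (R : DyadicCube n) : 0 ≤ coeffEnergy g R :=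
  Finset.sum_nonneg fun _ _ => sq_nonneg _

namespace StoppingData

lemma nodeSum_coeffEnergy_f (h : StoppingData b f c a mf mb st Q) (k : ℕ) :
    nodeSum st (coeffEnergy f) k Q ≤ 4 ^ n * a * mf ^ 2 * Q.vol :=
  nodeSum_coeffEnergy_le h.integrable_f h.one_le h.mf_nonneg h.root_f h.avg_f k

lemma nodeSum_coeffEnergy_b (h : StoppingData b f c a mf mb st Q) (k : ℕ) :
    nodeSum st (coeffEnergy b) k Q ≤ 4 ^ n * a * mb ^ 2 * Q.vol := by
  refine le_trans ?_ (nodeSum_coeffEnergy_le (st := st)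
    (integrableOn_sub_const h.integrable_b c) h.one_le h.mb_nonneg h.root_b h.avg_b k)
  refine nodeSum_mono (I := fun R => R.carrier ⊆ Q.carrier)
    (fun R hR _ σ => (R.child_subset σ).trans hR) (fun R hR _ => ?_) Subset.rfl
  rw [coeffEnergy_sub_const (h.integrable_b.mono_set hR)]

end StoppingData

/-- A cancellative Haar coefficient of `b` over a cube where `|b - c|` has average at most `t`. -/
lemma abs_haarCoeff_le_of_avg {t : ℝ} (hb : IntegrableOn b R.carrier volume)
    (h : ∫ x in R.carrier, |b x - c| ≤ t * R.vol) {ε : Fin n → Bool} (hε : ε ∈ cancellative n) :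
    |haarCoeff b R ε| ≤ √R.vol * t := by
  have hv := R.vol_pos
  rw [← haarCoeff_sub_const hb hε c]
  refine (abs_haarCoeff_le (integrableOn_sub_const hb c) ε).trans ?_
  rw [inv_mul_le_iff₀ (Real.sqrt_pos.2 hv), ← mul_assoc, Real.mul_self_sqrt hv.le, mul_comm]
  exact h

lemma abs_haarCoeff_le_of_avg' {t : ℝ} (hf : IntegrableOn f R.carrier volume)
    (h : ∫ x in R.carrier, |f x| ≤ t * R.vol) {ε : Fin n → Bool} (hε : ε ∈ cancellative n) :
    |haarCoeff f R ε| ≤ √R.vol * t :=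
  abs_haarCoeff_le_of_avg (c := 0) hf (by simpa using h) hε

lemma sum_cancellative_le {F : (Fin n → Bool) → ℝ} {t : ℝ} (ht : 0 ≤ t)
    (h : ∀ ε ∈ cancellative n, F ε ≤ t) : ∑ ε ∈ cancellative n, F ε ≤ 2 ^ n * t := by
  refine (Finset.sum_le_card_nsmul _ _ t h).trans ?_
  rw [nsmul_eq_mul]
  exact mul_le_mul_of_nonneg_right card_cancellative_le ht

/-! ### The terms of the paraproducts -/

lemma isHaarLike_paraTerm (b f : (Fin n → ℝ) → ℝ) : IsHaarLike (paraTerm b f) where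
  zero_of_notMem Q x hx := by simp [paraTerm, haar_eq_zero hx]
  const_child Q σ x y hx hy := by
    simp only [paraTerm, haar_eq_of_mem_child hx, haar_eq_of_mem_child hy]

lemma isHaarLike_paraAdjTerm (b f : (Fin n → ℝ) → ℝ) : IsHaarLike (paraAdjTerm b f) where
  zero_of_notMem Q x hx := by simp [paraAdjTerm, hx]
  const_child Q σ x y hx hy := by
    simp only [paraAdjTerm, indicator_of_mem (Q.child_subset σ hx),
      indicator_of_mem (Q.child_subset σ hy), Pi.one_apply]

lemma isHaarLike_gammaTerm (b f : (Fin n → ℝ) → ℝ) : IsHaarLike (gammaTerm b f) where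
  zero_of_notMem Q x hx := by simp [gammaTerm, haar_eq_zero hx]
  const_child Q σ x y hx hy := by
    simp only [gammaTerm, haar_eq_of_mem_child hx, haar_eq_of_mem_child hy]

/-- A common majorant of the terms of the paraproducts `Π_b^*` and `Γ_b`. -/
def absTerm (b f : (Fin n → ℝ) → ℝ) (Q : DyadicCube n) (x : Fin n → ℝ) : ℝ :=
  Q.carrier.indicator 1 x *
    (Q.vol⁻¹ * ((∑ ε ∈ cancellative n, |haarCoeff b Q ε|) *
      ∑ η ∈ cancellative n, |haarCoeff f Q η|))

lemma isHaarLike_absTerm (b f : (Fin n → ℝ) → ℝ) : IsHaarLike (absTerm b f) where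
  zero_of_notMem Q x hx := by simp [absTerm, hx]
  const_child Q σ x y hx hy := by
    simp only [absTerm, indicator_of_mem (Q.child_subset σ hx),
      indicator_of_mem (Q.child_subset σ hy), Pi.one_apply]

lemma absTerm_nonneg (b f : (Fin n → ℝ) → ℝ) (Q : DyadicCube n) (x : Fin n → ℝ) :
    0 ≤ absTerm b f Q x := by
  have := Q.vol_pos
  refine mul_nonneg (indicator_nonneg (fun _ _ => zero_le_one) x) ?_
  positivity

lemma abs_paraAdjTerm_le (b f : (Fin n → ℝ) → ℝ) (Q : DyadicCube n) (x : Fin n → ℝ) :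
    |paraAdjTerm b f Q x| ≤ absTerm b f Q x := by
  by_cases hx : x ∈ Q.carrier
  · have hv := Q.vol_pos
    simp only [paraAdjTerm, absTerm, indicator_of_mem hx, Pi.one_apply, one_mul]
    refine (Finset.abs_sum_le_sum_abs _ _).trans ?_
    rw [Finset.sum_mul, Finset.mul_sum]
    refine Finset.sum_le_sum fun ε hε => ?_
    rw [abs_mul, abs_mul, abs_of_pos (one_div_pos.2 hv), one_div, mul_comm]
    gcongr
    exact Finset.single_le_sum (f := fun η => |haarCoeff f Q η|) (fun η _ => abs_nonneg _) hε
  · rw [(isHaarLike_paraAdjTerm b f).zero_of_notMem Q x hx, abs_zero]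
    exact absTerm_nonneg b f Q x

lemma abs_gammaTerm_le (b f : (Fin n → ℝ) → ℝ) (Q : DyadicCube n) (x : Fin n → ℝ) :
    |gammaTerm b f Q x| ≤ absTerm b f Q x := by
  by_cases hx : x ∈ Q.carrier
  · have hv := Q.vol_pos
    simp only [gammaTerm, absTerm, indicator_of_mem hx, Pi.one_apply, one_mul]
    refine (Finset.abs_sum_le_sum_abs _ _).trans ?_
    rw [Finset.sum_mul, Finset.mul_sum]
    refine Finset.sum_le_sum fun ε hε => (Finset.abs_sum_le_sum_abs _ _).trans ?_
    rw [Finset.mul_sum, Finset.mul_sum]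
    refine (Finset.sum_le_sum_of_subset_of_nonneg (Finset.filter_subset _ _)
      fun η _ _ => abs_nonneg _).trans (Finset.sum_le_sum fun η _ => ?_)
    rw [abs_mul, abs_mul, mul_comm, abs_mul, abs_of_nonneg (inv_nonneg.2 (Real.sqrt_nonneg _))]
    gcongr
    rw [← inv_sqrt_vol_mul_self]
    gcongr
    exact abs_haar_le _ _ _
  · rw [(isHaarLike_gammaTerm b f).zero_of_notMem Q x hx, abs_zero]
    exact absTerm_nonneg b f Q x

lemma abs_paraTerm_le (hb : IntegrableOn b R.carrier volume)
    (ha : 0 ≤ a) (hmf : 0 ≤ mf) (hmb : 0 ≤ mb)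
    (h1 : ∫ x in R.carrier, |f x| ≤ a * mf * R.vol)
    (h2 : ∫ x in R.carrier, |b x - c| ≤ a * mb * R.vol) (x : Fin n → ℝ) :
    |paraTerm b f R x| ≤ 4 ^ n * a ^ 2 * mb * mf := by
  have hs := Real.sqrt_pos.2 R.vol_pos
  have h : |paraTerm b f R x| ≤ 2 ^ n * (a ^ 2 * mb * mf) := by
    refine (Finset.abs_sum_le_sum_abs _ _).trans
      (sum_cancellative_le (by positivity) fun ε hε => ?_)
    rw [abs_mul, abs_mul]
    calc |haarCoeff b R ε| * |cubeAvg f R| * |haar R ε x|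
        ≤ (√R.vol * (a * mb)) * (a * mf) * (√R.vol)⁻¹ := by
          gcongr
          · exact abs_haarCoeff_le_of_avg hb h2 hε
          · exact abs_cubeAvg_le h1
          · exact abs_haar_le _ _ _
      _ = a ^ 2 * mb * mf := by field_simp
  refine h.trans ?_
  rw [← mul_assoc, ← mul_assoc]
  gcongr
  norm_num

lemma abs_absTerm_le (hb : IntegrableOn b R.carrier volume) (hf : IntegrableOn f R.carrier volume)
    (ha : 0 ≤ a) (hmf : 0 ≤ mf) (hmb : 0 ≤ mb)
    (h1 : ∫ x in R.carrier, |f x| ≤ a * mf * R.vol)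
    (h2 : ∫ x in R.carrier, |b x - c| ≤ a * mb * R.vol) (x : Fin n → ℝ) :
    |absTerm b f R x| ≤ 4 ^ n * a ^ 2 * mb * mf := by
  have hv := R.vol_pos
  rw [abs_of_nonneg (absTerm_nonneg b f R x)]
  by_cases hx : x ∈ R.carrier
  · simp only [absTerm, indicator_of_mem hx, Pi.one_apply, one_mul]
    calc R.vol⁻¹ * ((∑ ε ∈ cancellative n, |haarCoeff b R ε|) *
          ∑ η ∈ cancellative n, |haarCoeff f R η|)
        ≤ R.vol⁻¹ * ((2 ^ n * (√R.vol * (a * mb))) * (2 ^ n * (√R.vol * (a * mf)))) := by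
          gcongr
          · exact sum_cancellative_le (by positivity) fun ε hε => abs_haarCoeff_le_of_avg hb h2 hε
          · exact sum_cancellative_le (by positivity) fun ε hε => abs_haarCoeff_le_of_avg' hf h1 hε
      _ = (R.vol⁻¹ * (√R.vol * √R.vol)) * ((2 * 2) ^ n * a ^ 2 * mb * mf) := by
          rw [mul_pow]; ring
      _ = 4 ^ n * a ^ 2 * mb * mf := by
          rw [Real.mul_self_sqrt hv.le, inv_mul_cancel₀ hv.ne', one_mul]; norm_num
  · rw [(isHaarLike_absTerm b f).zero_of_notMem R x hx]
    positivity

lemma sum_paraTerm_child (b f : (Fin n → ℝ) → ℝ) (R : DyadicCube n) :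
    ∑ σ, paraTerm b f R (R.child σ).corner = 0 := by
  simp only [paraTerm, haar_eq_of_mem_child (DyadicCube.corner_mem _)]
  rw [Finset.sum_comm]
  refine Finset.sum_eq_zero fun ε hε => ?_
  rw [← Finset.mul_sum, ← Finset.mul_sum, sum_haarSign hε, mul_zero, mul_zero]

lemma termEnergy_paraTerm_le (b f : (Fin n → ℝ) → ℝ) (R : DyadicCube n) :
    termEnergy (paraTerm b f) R ≤ 2 ^ n * cubeAvg f R ^ 2 * coeffEnergy b R := by
  have hv := R.vol_pos
  have h : ∀ σ, paraTerm b f R (R.child σ).corner ^ 2 ≤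
      2 ^ n * cubeAvg f R ^ 2 * coeffEnergy b R * R.vol⁻¹ := by
    intro σ
    refine sq_sum_le_card_mul_sum_sq.trans ?_
    have h1 : ∀ ε, (haarCoeff b R ε * cubeAvg f R * haar R ε (R.child σ).corner) ^ 2 =
        haarCoeff b R ε ^ 2 * (cubeAvg f R ^ 2 * R.vol⁻¹) := by
      intro ε
      rw [haar_eq_of_mem_child (DyadicCube.corner_mem _), mul_pow, mul_pow, mul_pow, haarSign_sq,
        sq (√R.vol)⁻¹, inv_sqrt_vol_mul_self]
      ring
    simp only [h1, ← Finset.sum_mul]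
    calc ((cancellative n).card : ℝ) * (coeffEnergy b R * (cubeAvg f R ^ 2 * R.vol⁻¹))
        ≤ 2 ^ n * (coeffEnergy b R * (cubeAvg f R ^ 2 * R.vol⁻¹)) := by
          refine mul_le_mul_of_nonneg_right card_cancellative_le ?_
          have := coeffEnergy_nonneg b R
          positivity
      _ = _ := by ring
  calc termEnergy (paraTerm b f) R
      ≤ ∑ σ, (R.child σ).vol * (2 ^ n * cubeAvg f R ^ 2 * coeffEnergy b R * R.vol⁻¹) :=
        Finset.sum_le_sum fun σ _ => mul_le_mul_of_nonneg_left (h σ) (R.child σ).vol_pos.le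
    _ = _ := by
        rw [← Finset.sum_mul, R.sum_child_vol]
        field_simp

namespace StoppingData

lemma nodeSum_termEnergy_paraTerm (h : StoppingData b f c a mf mb st Q) (k : ℕ) :
    nodeSum st (termEnergy (paraTerm b f)) k Q ≤ 8 ^ n * a ^ 3 * (mb * mf) ^ 2 * Q.vol := by
  have h1 : nodeSum st (termEnergy (paraTerm b f)) k Q ≤
      nodeSum st (fun R => (2 ^ n * (a * mf) ^ 2) * coeffEnergy b R) k Q := by
    refine nodeSum_mono (I := fun _ => True) (fun _ _ _ _ => trivial) (fun R _ hs => ?_) trivial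
    refine (termEnergy_paraTerm_le b f R).trans ?_
    have := coeffEnergy_nonneg b R
    rw [← sq_abs (cubeAvg f R)]
    gcongr
    exact abs_cubeAvg_le (h.avg_f R hs)
  rw [nodeSum_const_mul] at h1
  calc _ ≤ _ := h1
    _ ≤ (2 ^ n * (a * mf) ^ 2) * (4 ^ n * a * mb ^ 2 * Q.vol) := by
        gcongr
        exact h.nodeSum_coeffEnergy_b k
    _ = _ := by
        rw [show (8 : ℝ) = 2 * 4 by norm_num, mul_pow (2 : ℝ) 4]; ring

/-- The `L²` potential for the partial sums of `Π_b`. -/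
lemma leafSum_paraTerm_le (h : StoppingData b f c a mf mb st Q) (hn : 0 < n) (hQ : Q ∈ D.cubes)
    (k : ℕ) :
    leafSum st (fun R => ((8 ^ n * a ^ 2 * mb * mf) ^ 2)⁻¹ *
      (R.vol * sumAbove D (paraTerm b f) Q R ^ 2)) k Q ≤ a⁻¹ * Q.vol := by
  have ha : 0 < a := zero_lt_one.trans_le h.one_le
  have hv := Q.vol_pos
  have hmf := h.mf_nonneg
  have hmb := h.mb_nonneg
  rw [leafSum_const_mul]
  rcases (mul_nonneg hmb hmf).eq_or_lt with h0 | hpos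
  · rw [show (8 : ℝ) ^ n * a ^ 2 * mb * mf = 0 by rw [mul_assoc, ← h0, mul_zero]]
    simp only [ne_eq, OfNat.ofNat_ne_zero, not_false_eq_true, zero_pow, inv_zero, zero_mul]
    positivity
  have h1 := (leafSum_sumAbove_sq_le (D := D) hn (isHaarLike_paraTerm b f) (sum_paraTerm_child b f)
    hQ st k).trans (h.nodeSum_termEnergy_paraTerm k)
  have h8 : (1 : ℝ) ≤ 8 ^ n := one_le_pow₀ (by norm_num)
  rw [mul_assoc _ mb, inv_mul_le_iff₀ (by positivity)]
  refine h1.trans ?_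
  calc 8 ^ n * a ^ 3 * (mb * mf) ^ 2 * Q.vol
      = 8 ^ n * 1 * (a ^ 3 * (mb * mf) ^ 2 * Q.vol) := by ring
    _ ≤ 8 ^ n * 8 ^ n * (a ^ 3 * (mb * mf) ^ 2 * Q.vol) := by gcongr
    _ = (8 ^ n * a ^ 2 * (mb * mf)) ^ 2 * (a⁻¹ * Q.vol) := by
        field_simp

lemma nodeSum_absTerm_le (h : StoppingData b f c a mf mb st Q) (hpos : 0 < mb * mf) (k : ℕ) :
    nodeSum st (fun R => (∑ ε ∈ cancellative n, |haarCoeff b R ε|) *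
      ∑ η ∈ cancellative n, |haarCoeff f R η|) k Q ≤ 8 ^ n * a * (mb * mf) * Q.vol := by
  have hmf : 0 < mf := pos_of_mul_pos_right hpos h.mb_nonneg
  have hmb : 0 < mb := pos_of_mul_pos_left hpos h.mf_nonneg
  have hsq : ∀ (g : (Fin n → ℝ) → ℝ) R,
      (∑ ε ∈ cancellative n, |haarCoeff g R ε|) ^ 2 ≤ 2 ^ n * coeffEnergy g R := by
    intro g R
    refine sq_sum_le_card_mul_sum_sq.trans ?_
    simp only [sq_abs]
    exact mul_le_mul_of_nonneg_right card_cancellative_le (coeffEnergy_nonneg g R)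
  -- the weight `θ` balances the energies of `b` and `f`
  set θ : ℝ := mf / mb with hθ
  have hθ0 : 0 < θ := by positivity
  have hnode : nodeSum st (fun R => (∑ ε ∈ cancellative n, |haarCoeff b R ε|) *
      ∑ η ∈ cancellative n, |haarCoeff f R η|) k Q ≤
      nodeSum st (fun R => (2 ^ n * θ / 2) * coeffEnergy b R +
        (2 ^ n * θ⁻¹ / 2) * coeffEnergy f R) k Q := by
    refine nodeSum_mono (I := fun _ => True) (fun _ _ _ _ => trivial) (fun R _ _ => ?_) trivial
    set X := ∑ ε ∈ cancellative n, |haarCoeff b R ε| with hX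
    set Y := ∑ η ∈ cancellative n, |haarCoeff f R η| with hY
    have hXY : X * Y ≤ θ / 2 * X ^ 2 + θ⁻¹ / 2 * Y ^ 2 := by
      have h2 : θ / 2 * X ^ 2 + θ⁻¹ / 2 * Y ^ 2 - X * Y = θ⁻¹ / 2 * (θ * X - Y) ^ 2 := by
        field_simp; ring
      have : 0 ≤ θ⁻¹ / 2 * (θ * X - Y) ^ 2 := by positivity
      linarith
    have h3 : θ / 2 * X ^ 2 ≤ θ / 2 * (2 ^ n * coeffEnergy b R) := by gcongr; exact hsq b R
    have h4 : θ⁻¹ / 2 * Y ^ 2 ≤ θ⁻¹ / 2 * (2 ^ n * coeffEnergy f R) := by gcongr; exact hsq f R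
    linarith
  rw [nodeSum_add, nodeSum_const_mul, nodeSum_const_mul] at hnode
  calc _ ≤ _ := hnode
    _ ≤ (2 ^ n * θ / 2) * (4 ^ n * a * mb ^ 2 * Q.vol) +
        (2 ^ n * θ⁻¹ / 2) * (4 ^ n * a * mf ^ 2 * Q.vol) := by
        gcongr
        · exact h.nodeSum_coeffEnergy_b k
        · exact h.nodeSum_coeffEnergy_f k
    _ = 8 ^ n * a * (mb * mf) * Q.vol := by
        rw [show (8 : ℝ) = 2 * 4 by norm_num, mul_pow, hθ]
        field_simp
        ring

/-- The `L¹` potential for the partial sums of the majorants. -/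
lemma leafSum_absTerm_le (h : StoppingData b f c a mf mb st Q) (hn : 0 < n) (hQ : Q ∈ D.cubes)
    (k : ℕ) :
    leafSum st (fun R => (8 ^ n * a ^ 2 * mb * mf)⁻¹ *
      (R.vol * sumAbove D (absTerm b f) Q R)) k Q ≤ a⁻¹ * Q.vol := by
  have ha : 0 < a := zero_lt_one.trans_le h.one_le
  have hv := Q.vol_pos
  rw [leafSum_const_mul]
  rcases (mul_nonneg h.mb_nonneg h.mf_nonneg).eq_or_lt with h0 | hpos
  · rw [show (8 : ℝ) ^ n * a ^ 2 * mb * mf = 0 by rw [mul_assoc, ← h0, mul_zero]]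
    simp only [inv_zero, zero_mul]
    positivity
  have h1 : leafSum st (fun R => R.vol * sumAbove D (absTerm b f) Q R) k Q ≤
      nodeSum st (fun R => (∑ ε ∈ cancellative n, |haarCoeff b R ε|) *
        ∑ η ∈ cancellative n, |haarCoeff f R η|) k Q := by
    rw [leafSum_eq, sumAbove_self, mul_zero, zero_add]
    refine nodeSum_mono (I := fun R => R ∈ D.subcubes Q)
      (fun R hR _ σ => subcubes_child hn hR σ) (fun R hR _ => le_of_eq ?_) ⟨hQ, Subset.rfl⟩
    have hR0 := R.vol_pos
    have hc : ∀ σ, absTerm b f R (R.child σ).corner =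
        R.vol⁻¹ * ((∑ ε ∈ cancellative n, |haarCoeff b R ε|) *
          ∑ η ∈ cancellative n, |haarCoeff f R η|) := by
      intro σ
      rw [absTerm, indicator_of_mem (R.child_subset σ (DyadicCube.corner_mem _)), Pi.one_apply,
        one_mul]
    simp only [sumAbove_child (isHaarLike_absTerm b f) hn hR.1 hR.2, hc, ← Finset.sum_mul,
      R.sum_child_vol]
    field_simp
    ring
  rw [mul_assoc _ mb, inv_mul_le_iff₀ (by positivity)]
  refine (h1.trans (h.nodeSum_absTerm_le hpos k)).trans_eq ?_
  field_simp

end StoppingData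

end LocalEstimates

/-! ### Sparse domination of the paraproducts -/

section Domination

variable {n : ℕ} {D : DyadicGrid n} {b f w : (Fin n → ℝ) → ℝ}
  {T : DyadicCube n → (Fin n → ℝ) → ℝ}

/-- The cube `R` is stopped from `Q` if the average over `R` of `|f|` or of `|b - c|` is more than
`a` times the bound `mf` or `mb` for its average over `Q`, or if the sum of the terms of the cubes
from `Q` down to `R` is large. -/
def stopCond (D : DyadicGrid n) (T : DyadicCube n → (Fin n → ℝ) → ℝ) (b f : (Fin n → ℝ) → ℝ)
    (c a mf mb : ℝ) (Q R : DyadicCube n) : Prop :=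
  a * mf * R.vol < ∫ x in R.carrier, |f x| ∨ a * mb * R.vol < ∫ x in R.carrier, |b x - c| ∨
    8 ^ n * a ^ 2 * mb * mf < |sumAbove D T Q R|

lemma stoppingData_stopCond {c a mf mb : ℝ} {Q : DyadicCube n}
    (hb : IntegrableOn b Q.carrier volume) (hf : IntegrableOn f Q.carrier volume) (ha : 1 ≤ a)
    (hmf : 0 ≤ mf) (hmb : 0 ≤ mb) (h1 : ∫ x in Q.carrier, |f x| ≤ mf * Q.vol)
    (h2 : ∫ x in Q.carrier, |b x - c| ≤ mb * Q.vol) :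
    StoppingData b f c a mf mb (stopCond D T b f c a mf mb Q) Q :=
  ⟨hb, hf, ha, hmf, hmb, h1, h2, fun _ h => not_lt.1 fun h' => h (Or.inl h'),
    fun _ h => not_lt.1 fun h' => h (Or.inr (Or.inl h'))⟩

/-- The root of the stopping tree is not stopped. -/
lemma StoppingData.not_stopCond_self {c a mf mb : ℝ} {Q : DyadicCube n} {st : DyadicCube n → Prop}
    (h : StoppingData b f c a mf mb st Q) : ¬ stopCond D T b f c a mf mb Q Q := by
  have hmf := h.mf_nonneg
  have hmb := h.mb_nonneg
  have ha := h.one_le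
  have hv := Q.vol_pos
  rintro (h' | h' | h')
  · have : mf * Q.vol ≤ a * mf * Q.vol := by
      rw [mul_assoc]; exact le_mul_of_one_le_left (by positivity) ha
    linarith [h.root_f]
  · have : mb * Q.vol ≤ a * mb * Q.vol := by
      rw [mul_assoc]; exact le_mul_of_one_le_left (by positivity) ha
    linarith [h.root_b]
  · rw [sumAbove_self, abs_zero] at h'
    exact absurd h' (not_lt.2 (by positivity))

lemma vol_le_inv_mul_integral {g : (Fin n → ℝ) → ℝ} {a m : ℝ} {Q R : DyadicCube n} (ha : 0 < a)
    (hm : 0 ≤ m) (hg : IntegrableOn g Q.carrier volume)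
    (hQ : ∫ x in Q.carrier, |g x| ≤ m * Q.vol) (hR : R.carrier ⊆ Q.carrier)
    (h : a * m * R.vol < ∫ x in R.carrier, |g x|) :
    R.vol ≤ (a * m)⁻¹ * ∫ x in R.carrier, |g x| := by
  rcases hm.eq_or_lt with rfl | hm
  · have h1 : ∫ x in R.carrier, |g x| ≤ ∫ x in Q.carrier, |g x| :=
      setIntegral_mono_set hg.abs (Eventually.of_forall fun _ => abs_nonneg _) hR.eventuallyLE
    simp only [mul_zero, zero_mul] at h hQ
    linarith
  · rw [le_inv_mul_iff₀ (by positivity)]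
    exact h.le

lemma inv_mul_integral_le {g : (Fin n → ℝ) → ℝ} {a m : ℝ} {Q : DyadicCube n} (ha : 0 < a)
    (hm : 0 ≤ m) (hQ : ∫ x in Q.carrier, |g x| ≤ m * Q.vol) :
    (a * m)⁻¹ * ∫ x in Q.carrier, |g x| ≤ a⁻¹ * Q.vol := by
  have hv := Q.vol_pos
  rcases hm.eq_or_lt with rfl | hm
  · simp only [mul_zero, inv_zero, zero_mul]; positivity
  · rw [inv_mul_le_iff₀ (by positivity)]
    refine hQ.trans_eq ?_
    field_simp

/-- The stopped cubes cover at most the fraction `3 / a` of `Q`: each of the three reasons for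
stopping accounts for the fraction `1 / a`. The potential `φ` takes care of the third one. -/
lemma volume_stopCond_le (hn : 0 < n) (hT : IsHaarLike T) {c a mf mb : ℝ} {Q : DyadicCube n}
    (hQ : Q ∈ D.cubes) (h : StoppingData b f c a mf mb (stopCond D T b f c a mf mb Q) Q)
    (hJ : ∀ R ∈ D.subcubes Q, ∫ x in R.carrier, |f x| ≤ a * mf * R.vol →
      ∫ x in R.carrier, |b x - c| ≤ a * mb * R.vol → ∀ x, |T R x| ≤ 4 ^ n * a ^ 2 * mb * mf)
    {φ : DyadicCube n → ℝ} (hφ0 : ∀ R ∈ D.subcubes Q, 0 ≤ φ R)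
    (hφ : ∀ R ∈ D.subcubes Q, 0 < mb * mf → 8 ^ n * a ^ 2 * mb * mf < |sumAbove D T Q R| →
      R.vol ≤ φ R)
    (hφs : ∀ k, leafSum (stopCond D T b f c a mf mb Q) φ k Q ≤ a⁻¹ * Q.vol) :
    volume (⋃ k, hitSet (stopCond D T b f c a mf mb Q) (stopCond D T b f c a mf mb Q) k Q) ≤
      ENNReal.ofReal (3 * a⁻¹ * Q.vol) := by
  have ha : 0 < a := zero_lt_one.trans_le h.one_le
  have hmf := h.mf_nonneg
  have hmb := h.mb_nonneg
  have hg := integrableOn_sub_const h.integrable_b c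
  -- the sum above a leaf exceeds the threshold at most by one term; in particular it vanishes if
  -- `mb * mf = 0`
  let I : DyadicCube n → Prop := fun R => R ∈ D.subcubes Q ∧
    |sumAbove D T Q R| ≤ 8 ^ n * a ^ 2 * mb * mf + 4 ^ n * a ^ 2 * mb * mf
  have hint : ∀ (g : (Fin n → ℝ) → ℝ) (m : ℝ), 0 ≤ m → ∀ R : DyadicCube n,
      0 ≤ (a * m)⁻¹ * ∫ x in R.carrier, |g x| := fun g m hm R =>
    mul_nonneg (by positivity) (integral_nonneg fun x => abs_nonneg (g x))
  refine volume_iUnion_hitSet_le (I := I)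
    (φ := fun R => (a * mf)⁻¹ * (∫ x in R.carrier, |f x|) +
      ((a * mb)⁻¹ * (∫ x in R.carrier, |b x - c|) + φ R)) (fun R hR => hR) ?_ ?_ ?_ ?_ ?_
  · rintro R ⟨hR, -⟩ hs σ
    refine ⟨subcubes_child hn hR σ, ?_⟩
    rw [sumAbove_child hT hn hR.1 hR.2]
    refine (abs_add_le _ _).trans (add_le_add ?_ ?_)
    · exact not_lt.1 fun h' => hs (Or.inr (Or.inr h'))
    · exact hJ R hR (h.avg_f R hs) (h.avg_b R hs) _
  · intro R hR
    exact add_nonneg (hint f mf hmf R)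
      (add_nonneg (hint (fun x => b x - c) mb hmb R) (hφ0 R hR.1))
  · rintro R ⟨hR, hle⟩ hs
    have h1 := hint f mf hmf R
    have h2 := hint (fun x => b x - c) mb hmb R
    have h3 := hφ0 R hR
    rcases hs with hs | hs | hs
    · have := vol_le_inv_mul_integral ha hmf h.integrable_f h.root_f hR.2 hs
      linarith
    · have := vol_le_inv_mul_integral ha hmb hg h.root_b hR.2 hs
      linarith
    · rcases (mul_nonneg hmb hmf).eq_or_lt with h0 | h0
      · rw [mul_assoc _ mb, mul_assoc _ mb, ← h0] at hle
        rw [mul_assoc _ mb, ← h0] at hs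
        linarith
      · have := hφ R hR h0 hs
        linarith
  · refine ⟨⟨hQ, Subset.rfl⟩, ?_⟩
    rw [sumAbove_self, abs_zero]
    positivity
  · intro k
    rw [leafSum_add, leafSum_add, leafSum_const_mul, leafSum_const_mul,
      leafSum_integral k h.integrable_f.abs, leafSum_integral k hg.abs]
    have h1 := inv_mul_integral_le ha hmf h.root_f
    have h2 := inv_mul_integral_le ha hmb h.root_b
    linarith [hφs k]

/-- Up to the first stopped cube the partial sums are bounded. -/
lemma abs_sum_le_of_not_stopCond (hn : 0 < n) (hT : IsHaarLike T) {c a mf mb : ℝ}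
    {Q : DyadicCube n} (hQ : Q ∈ D.cubes)
    (h : StoppingData b f c a mf mb (stopCond D T b f c a mf mb Q) Q)
    (hJ : ∀ R ∈ D.subcubes Q, ∫ x in R.carrier, |f x| ≤ a * mf * R.vol →
      ∫ x in R.carrier, |b x - c| ≤ a * mb * R.vol → ∀ x, |T R x| ≤ 4 ^ n * a ^ 2 * mb * mf)
    {x : Fin n → ℝ} (hx : x ∈ Q.carrier) {j : ℕ}
    (hj : ∀ i, 0 < i → i < j → ¬ stopCond D T b f c a mf mb Q (D.descend Q x i)) :
    |∑ i ∈ Finset.range j, T (D.descend Q x i) x| ≤ 2 * 8 ^ n * a ^ 2 * (mb * mf) := by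
  have hmf := h.mf_nonneg
  have hmb := h.mb_nonneg
  rcases Nat.eq_zero_or_pos j with rfl | hj0
  · simp only [Finset.range_zero, Finset.sum_empty, abs_zero]
    positivity
  obtain ⟨i, rfl⟩ : ∃ i, j = i + 1 := ⟨j - 1, by omega⟩
  have hs : ¬ stopCond D T b f c a mf mb Q (D.descend Q x i) := by
    rcases Nat.eq_zero_or_pos i with rfl | hi
    · rw [DyadicGrid.descend_zero hQ hx]; exact h.not_stopCond_self
    · exact hj i hi (Nat.lt_succ_self i)
  have h1 : |sumAbove D T Q (D.descend Q x i)| ≤ 8 ^ n * a ^ 2 * mb * mf :=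
    not_lt.1 fun h' => hs (Or.inr (Or.inr h'))
  have h2 := hJ _ (descend_mem_subcubes hn hQ hx i) (h.avg_f _ hs) (h.avg_b _ hs) x
  have h3 : 4 ^ n * a ^ 2 * mb * mf ≤ 8 ^ n * a ^ 2 * mb * mf := by gcongr; norm_num
  rw [sumAbove_descend hT hn] at h1
  rw [Finset.sum_range_succ]
  refine (abs_add_le _ _).trans ?_
  linarith

/-- Sparse domination for terms with a potential for their partial sums. -/
theorem exists_sparse_of_potential (hn : 0 < n) {Q₀ : DyadicCube n} (hQ₀ : Q₀ ∈ D.cubes) {Λ : ℝ}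
    (hΛ : 1 < Λ) (hT : IsHaarLike T) (hb : LocallyIntegrable b volume)
    (hf : IntegrableOn f Q₀.carrier volume) {m : DyadicCube n → ℝ} (hm : ∀ Q ∈ D.cubes, 0 ≤ m Q)
    (hosc : ∀ Q ∈ D.cubes, ∫ x in Q.carrier, |b x - cubeAvg b Q| ≤ m Q * Q.vol)
    (hJ : ∀ R ∈ D.subcubes Q₀, ∀ c a mf mb, 0 ≤ a → 0 ≤ mf → 0 ≤ mb →
      ∫ x in R.carrier, |f x| ≤ a * mf * R.vol →
      ∫ x in R.carrier, |b x - c| ≤ a * mb * R.vol → ∀ x, |T R x| ≤ 4 ^ n * a ^ 2 * mb * mf)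
    (hφ : ∀ Q ∈ D.subcubes Q₀, ∀ c a mf mb st, StoppingData b f c a mf mb st Q →
      ∃ φ : DyadicCube n → ℝ, (∀ R ∈ D.subcubes Q, 0 ≤ φ R) ∧
        (∀ R ∈ D.subcubes Q, 0 < mb * mf → 8 ^ n * a ^ 2 * mb * mf < |sumAbove D T Q R| →
          R.vol ≤ φ R) ∧ ∀ k, leafSum st φ k Q ≤ a⁻¹ * Q.vol)
    (hconv : ∀ Q ∈ D.subcubes Q₀, ∀ c a mf mb st, StoppingData b f c a mf mb st Q →
      (∀ R, ¬ st R → |sumAbove D T Q R| ≤ 8 ^ n * a ^ 2 * mb * mf) →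
      ∀ᵐ x, x ∈ Q.carrier → (∀ i, ¬ st (D.descend Q x i)) →
        ∃ s, Tendsto (fun j => ∑ i ∈ Finset.range j, T (D.descend Q x i) x) atTop (𝓝 s)) :
    ∃ S ⊆ D.subcubes Q₀, IsCarleson D Λ S ∧ IsSparse Λ⁻¹ S ∧
      (∀ᵐ x ∂(volume.restrict Q₀.carrier),
        ∃ s, Tendsto (fun j => ∑ i ∈ Finset.range j, T (D.descend Q₀ x i) x) atTop (𝓝 s)) ∧
      ∀ x ∈ Q₀.carrier, ∀ k, ENNReal.ofReal |∑ i ∈ Finset.range k, T (D.descend Q₀ x i) x| ≤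
        ∑' Q : S, Q.1.carrier.indicator (fun _ => ENNReal.ofReal
          (18 * 8 ^ n * (Λ / (Λ - 1)) ^ 2 * (m Q.1 * cubeAvg (fun y => |f y|) Q.1))) x := by
  have hΛ1 : 0 < Λ - 1 := sub_pos.2 hΛ
  have hL : 1 ≤ Λ / (Λ - 1) := by rw [one_le_div hΛ1]; linarith
  -- the three reasons for stopping together cover the fraction `3 / a = 1 - 1 / Λ`
  set a : ℝ := 3 * (Λ / (Λ - 1)) with ha
  have ha1 : 1 ≤ a := by linarith
  let mf : DyadicCube n → ℝ := cubeAvg fun y => |f y|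
  have hmf : ∀ Q, 0 ≤ mf Q := by
    intro Q
    simp only [mf, cubeAvg_eq]
    exact mul_nonneg (inv_nonneg.2 Q.vol_pos.le) (integral_nonneg fun x => abs_nonneg _)
  let st : DyadicCube n → DyadicCube n → Prop := fun Q =>
    stopCond D T b f (cubeAvg b Q) a (mf Q) (m Q) Q
  have hdata : ∀ Q ∈ D.subcubes Q₀,
      StoppingData b f (cubeAvg b Q) a (mf Q) (m Q) (st Q) Q := fun Q hQ =>
    stoppingData_stopCond (Q.integrableOn_of_locallyIntegrable hb) (hf.mono_set hQ.2) ha1 (hmf Q)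
      (hm Q hQ.1) (cubeAvg_mul_vol _ _).ge (hosc Q hQ.1)
  have hJ' : ∀ Q ∈ D.subcubes Q₀, ∀ R ∈ D.subcubes Q,
      ∫ x in R.carrier, |f x| ≤ a * mf Q * R.vol →
      ∫ x in R.carrier, |b x - cubeAvg b Q| ≤ a * m Q * R.vol →
      ∀ x, |T R x| ≤ 4 ^ n * a ^ 2 * m Q * mf Q := fun Q hQ R hR h1 h2 =>
    hJ R ⟨hR.1, hR.2.trans hQ.2⟩ _ a _ _ (by linarith) (hmf Q) (hm Q hQ.1) h1 h2
  refine exists_sparse_domination (st := st) (T := T)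
    (c := fun Q => 18 * 8 ^ n * (Λ / (Λ - 1)) ^ 2 * (m Q * cubeAvg (fun y => |f y|) Q))
    hn hQ₀ hΛ ?_ ?_ ?_
  · intro Q hQ
    obtain ⟨φ, h1, h2, h3⟩ := hφ Q hQ _ _ _ _ _ (hdata Q hQ)
    have := volume_stopCond_le hn hT hQ.1 (hdata Q hQ) (hJ' Q hQ) h1 h2 h3
    rwa [show 3 * a⁻¹ = 1 - Λ⁻¹ by rw [ha]; field_simp] at this
  · intro Q hQ x hx j hj
    have := abs_sum_le_of_not_stopCond hn hT hQ.1 (hdata Q hQ) (hJ' Q hQ) hx hj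
    refine this.trans_eq ?_
    rw [ha]; ring
  · intro Q hQ
    filter_upwards [hconv Q hQ _ _ _ _ _ (hdata Q hQ) fun R hs =>
      not_lt.1 fun h' => hs (Or.inr (Or.inr h'))] with x hx hxQ hi
    refine hx hxQ fun i => ?_
    rcases Nat.eq_zero_or_pos i with rfl | hi0
    · rw [DyadicGrid.descend_zero hQ.1 hxQ]; exact (hdata Q hQ).not_stopCond_self
    · exact hi i hi0

/-- Bounded partial sums of nonnegative terms converge. -/
lemma exists_tendsto_of_nonneg {u : ℕ → ℝ} (hu : ∀ i, 0 ≤ u i) {M : ℝ}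
    (h : ∀ j, ∑ i ∈ Finset.range j, u i ≤ M) :
    ∃ s, Tendsto (fun j => ∑ i ∈ Finset.range j, u i) atTop (𝓝 s) :=
  ⟨_, (summable_of_sum_range_le hu h).hasSum.tendsto_sum_nat⟩

/-- The averages of the oscillation of a function in the weighted space. -/
lemma integral_abs_sub_cubeAvg_le (hw : IsWeight w) (hb : MemBMO D w b) {Q : DyadicCube n}
    (hQ : Q ∈ D.cubes) :
    ∫ x in Q.carrier, |b x - cubeAvg b Q| ≤ (bmoNorm D w b).toReal * cubeAvg w Q * Q.vol := by
  have hwQ := Q.integrableOn_of_locallyIntegrable hw.1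
  have hbQ := integrableOn_sub_const (Q.integrableOn_of_locallyIntegrable hb.1) (cubeAvg b Q)
  have hpos : ∀ᵐ x ∂volume.restrict Q.carrier, 0 < w x := ae_restrict_of_ae hw.2
  have hI : ∫⁻ x in Q.carrier, ENNReal.ofReal (w x) = ENNReal.ofReal (∫ x in Q.carrier, w x) :=
    (ofReal_integral_eq_lintegral_ofReal hwQ (hpos.mono fun x hx => hx.le)).symm
  have hW : 0 < ∫ x in Q.carrier, w x := by
    rw [setIntegral_pos_iff_support_of_nonneg_ae (hpos.mono fun x hx => hx.le) hwQ]
    have : volume (Function.support w ∩ Q.carrier) = volume Q.carrier := by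
      refine measure_congr ?_
      filter_upwards [hw.2] with x hx
      exact propext ⟨fun h => h.2, fun h => ⟨hx.ne', h⟩⟩
    rw [this, Q.volume_eq_ofReal_vol]
    exact ENNReal.ofReal_pos.2 Q.vol_pos
  have h1 : (∫⁻ x in Q.carrier, ‖b x - cubeAvg b Q‖ₑ) / ENNReal.ofReal (∫ x in Q.carrier, w x) ≤
      bmoNorm D w b := by
    rw [← hI]
    exact le_iSup₂ (f := fun (Q : DyadicCube n) (_ : Q ∈ D.cubes) =>
      (∫⁻ x in Q.carrier, ‖b x - cubeAvg b Q‖ₑ) / ∫⁻ x in Q.carrier, ENNReal.ofReal (w x)) Q hQ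
  rw [ENNReal.div_le_iff (ENNReal.ofReal_pos.2 hW).ne' ENNReal.ofReal_ne_top] at h1
  have h2 : ∫ x in Q.carrier, |b x - cubeAvg b Q| =
      (∫⁻ x in Q.carrier, ‖b x - cubeAvg b Q‖ₑ).toReal :=
    integral_norm_eq_lintegral_enorm hbQ.aestronglyMeasurable
  rw [h2, mul_assoc, cubeAvg_mul_vol]
  refine (ENNReal.toReal_mono (ENNReal.mul_ne_top hb.2.ne ENNReal.ofReal_ne_top) h1).trans_eq ?_
  rw [ENNReal.toReal_mul, ENNReal.toReal_ofReal hW.le]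

lemma cubeAvg_nonneg_of_isWeight (hw : IsWeight w) (Q : DyadicCube n) : 0 ≤ cubeAvg w Q := by
  rw [cubeAvg_eq]
  exact mul_nonneg (inv_nonneg.2 Q.vol_pos.le)
    (integral_nonneg_of_ae (ae_restrict_of_ae (hw.2.mono fun x hx => hx.le)))

lemma tsum_eq_mul_sparseOp (hw : IsWeight w) (hb : MemBMO D w b) {K : ℝ} (hK : 0 ≤ K)
    (S : Set (DyadicCube n)) (x : Fin n → ℝ) :
    ∑' Q : S, Q.1.carrier.indicator (fun _ => ENNReal.ofReal
      (K * ((bmoNorm D w b).toReal * cubeAvg w Q.1 * cubeAvg (fun y => |f y|) Q.1))) x =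
      ENNReal.ofReal K * bmoNorm D w b * sparseOp w S f x := by
  rw [sparseOp, ← ENNReal.tsum_mul_left]
  refine tsum_congr fun Q => ?_
  by_cases hx : x ∈ Q.1.carrier
  · rw [indicator_of_mem hx, indicator_of_mem hx, ENNReal.ofReal_mul hK,
      ENNReal.ofReal_mul (mul_nonneg ENNReal.toReal_nonneg (cubeAvg_nonneg_of_isWeight hw _)),
      ENNReal.ofReal_mul ENNReal.toReal_nonneg, ENNReal.ofReal_toReal hb.2.ne]
    ring
  · rw [indicator_of_notMem hx, indicator_of_notMem hx, mul_zero]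

variable {Q₀ : DyadicCube n} {Λ : ℝ}

theorem sparselyDominated_paraTerm (hn : 0 < n) (hΛ : 1 < Λ) (hw : IsWeight w)
    (hb : MemBMO D w b) (hQ₀ : Q₀ ∈ D.cubes) (hf : IntegrableOn f Q₀.carrier volume) :
    SparselyDominated D Q₀ Λ
      (ENNReal.ofReal (18 * 8 ^ n * (Λ / (Λ - 1)) ^ 2) * bmoNorm D w b) w f (paraTerm b f) := by
  have hT := isHaarLike_paraTerm b f
  obtain ⟨S, hS, hC, hsp, hconv, hle⟩ := exists_sparse_of_potential (T := paraTerm b f)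
    (m := fun Q => (bmoNorm D w b).toReal * cubeAvg w Q) hn hQ₀ hΛ hT hb.1 hf
    (fun Q _ => mul_nonneg ENNReal.toReal_nonneg (cubeAvg_nonneg_of_isWeight hw Q))
    (fun Q hQ => integral_abs_sub_cubeAvg_le hw hb hQ)
    (fun R _ c a mf mb ha hmf hmb h1 h2 x =>
      abs_paraTerm_le (R.integrableOn_of_locallyIntegrable hb.1) ha hmf hmb h1 h2 x)
    (fun Q hQ c a mf mb st h => ⟨_, fun R _ => by have := R.vol_pos; positivity,
      fun R _ h0 hR => by
        have ha := zero_lt_one.trans_le h.one_le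
        have hlam : 0 < 8 ^ n * a ^ 2 * mb * mf := by rw [mul_assoc _ mb]; positivity
        rw [le_inv_mul_iff₀ (by positivity), mul_comm, ← sq_abs (sumAbove D _ Q R)]
        have := R.vol_pos
        gcongr,
      h.leafSum_paraTerm_le hn hQ.1⟩)
    (fun Q hQ c a mf mb st h _ => ae_tendsto_of_nodeSum_le hn hT (sum_paraTerm_child b f) hQ.1
      h.nodeSum_termEnergy_paraTerm)
  refine sparselyDominated_of_partialSums hn hQ₀ hT hS hC hsp hconv fun x hx k => ?_
  rw [← tsum_eq_mul_sparseOp hw hb (by positivity), Real.enorm_eq_ofReal_abs]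
  exact hle x hx k

/-- Sparse domination of every series with the majorant `absTerm`. -/
theorem sparselyDominated_of_le_absTerm (hn : 0 < n) (hΛ : 1 < Λ) (hw : IsWeight w)
    (hb : MemBMO D w b) (hQ₀ : Q₀ ∈ D.cubes) (hf : IntegrableOn f Q₀.carrier volume)
    (hT : IsHaarLike T) (hle : ∀ Q x, |T Q x| ≤ absTerm b f Q x) :
    SparselyDominated D Q₀ Λ
      (ENNReal.ofReal (18 * 8 ^ n * (Λ / (Λ - 1)) ^ 2) * bmoNorm D w b) w f T := by
  have hA := isHaarLike_absTerm b f
  have hnn : ∀ Q R, 0 ≤ sumAbove D (absTerm b f) Q R := fun Q R =>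
    Finset.sum_nonneg fun _ _ => absTerm_nonneg b f _ _
  obtain ⟨S, hS, hC, hsp, hconv, hbd⟩ := exists_sparse_of_potential (T := absTerm b f)
    (m := fun Q => (bmoNorm D w b).toReal * cubeAvg w Q) hn hQ₀ hΛ hA hb.1 hf
    (fun Q _ => mul_nonneg ENNReal.toReal_nonneg (cubeAvg_nonneg_of_isWeight hw Q))
    (fun Q hQ => integral_abs_sub_cubeAvg_le hw hb hQ)
    (fun R hR c a mf mb ha hmf hmb h1 h2 x =>
      abs_absTerm_le (R.integrableOn_of_locallyIntegrable hb.1) (hf.mono_set hR.2) ha hmf hmb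
        h1 h2 x)
    (fun Q hQ c a mf mb st h => ⟨_, fun R _ => by
        have := R.vol_pos
        have := hnn Q R
        have := h.mf_nonneg
        have := h.mb_nonneg
        positivity,
      fun R _ h0 hR => by
        have ha := zero_lt_one.trans_le h.one_le
        have hlam : 0 < 8 ^ n * a ^ 2 * mb * mf := by rw [mul_assoc _ mb]; positivity
        rw [le_inv_mul_iff₀ hlam, mul_comm]
        rw [abs_of_nonneg (hnn Q R)] at hR
        have := R.vol_pos
        gcongr,
      h.leafSum_absTerm_le hn hQ.1⟩)
    (fun Q hQ c a mf mb st h hF => Eventually.of_forall fun x _ hs =>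
      exists_tendsto_of_nonneg (fun i => absTerm_nonneg b f _ _) fun j => by
        have := hF _ (hs j)
        rw [sumAbove_descend hA hn] at this
        exact (le_abs_self _).trans this)
  refine sparselyDominated_of_partialSums hn hQ₀ hT hS hC hsp ?_ fun x hx k => ?_
  · filter_upwards [hconv] with x hx
    obtain ⟨s, hs⟩ := hx
    have h1 : Summable fun i => absTerm b f (D.descend Q₀ x i) x :=
      ((hasSum_iff_tendsto_nat_of_nonneg (fun i => absTerm_nonneg b f _ _) s).2 hs).summable
    have h2 : Summable fun i => T (D.descend Q₀ x i) x :=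
      Summable.of_norm_bounded h1 fun i => hle _ _
    exact ⟨_, h2.hasSum.tendsto_sum_nat⟩
  · rw [← tsum_eq_mul_sparseOp hw hb (by positivity), Real.enorm_eq_ofReal_abs]
    refine le_trans (ENNReal.ofReal_le_ofReal ?_) (hbd x hx k)
    exact (Finset.abs_sum_le_sum_abs _ _).trans
      ((Finset.sum_le_sum fun i _ => hle _ _).trans (le_abs_self _))

/-- In dimension `0` there are no cancellative Haar functions, and the series vanish. -/
lemma sparselyDominated_zero (K : ℝ≥0∞) (hT : ∀ Q x, T Q x = 0) :
    SparselyDominated D Q₀ Λ K w f T := by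
  have h0 : ∀ m x, truncatedSum D Q₀ T m x = 0 := fun m x => by simp [truncatedSum, hT]
  refine ⟨∅, empty_subset _, fun Q _ => ?_, ⟨fun _ => ∅, by simp, by simp⟩, ?_, ?_, ?_⟩
  · have : IsEmpty {P : DyadicCube n // P ∈ (∅ : Set (DyadicCube n)) ∧ P.carrier ⊆ Q.carrier} :=
      ⟨fun P => P.2.1⟩
    simp
  · exact Eventually.of_forall fun x => ⟨0, by simp [SumsTo, h0]⟩
  · intro x _ s hs
    simp only [SumsTo, h0] at hs
    simp [tendsto_nhds_unique hs tendsto_const_nhds]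
  · intro x _ m
    simp [h0]

end Domination
end

theorem theoremT (n : ℕ) :
    ∃ C : ℝ, 0 < C ∧
      ∀ (D : DyadicGrid n) (Λ : ℝ) (w b : (Fin n → ℝ) → ℝ) (Q₀ : DyadicCube n)
        (f : (Fin n → ℝ) → ℝ),
        1 < Λ → IsWeight w → MemBMO D w b → Q₀ ∈ D.cubes → IntegrableOn f Q₀.carrier volume →
          SparselyDominated D Q₀ Λ
            (ENNReal.ofReal (C * (Λ / (Λ - 1)) ^ 2) * bmoNorm D w b) w f (paraTerm b f) ∧
          SparselyDominated D Q₀ Λ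
            (ENNReal.ofReal (C * (Λ / (Λ - 1)) ^ 2) * bmoNorm D w b) w f (paraAdjTerm b f) ∧
          SparselyDominated D Q₀ Λ
            (ENNReal.ofReal (C * (Λ / (Λ - 1)) ^ 2) * bmoNorm D w b) w f (gammaTerm b f) := by
  refine ⟨18 * 8 ^ n, by positivity, fun D Λ w b Q₀ f hΛ hw hb hQ₀ hf => ?_⟩
  rcases Nat.eq_zero_or_pos n with rfl | hn
  · have hc : cancellative 0 = ∅ :=
      Finset.filter_eq_empty_iff.2 fun ε _ h => h (Subsingleton.elim _ _)
    exact ⟨sparselyDominated_zero _ fun Q x => by simp [paraTerm, hc],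
      sparselyDominated_zero _ fun Q x => by simp [paraAdjTerm, hc],
      sparselyDominated_zero _ fun Q x => by simp [gammaTerm, hc]⟩
  · exact ⟨sparselyDominated_paraTerm hn hΛ hw hb hQ₀ hf,
      sparselyDominated_of_le_absTerm hn hΛ hw hb hQ₀ hf (isHaarLike_paraAdjTerm b f)
        (abs_paraAdjTerm_le b f),
      sparselyDominated_of_le_absTerm hn hΛ hw hb hQ₀ hf (isHaarLike_gammaTerm b f)
        (abs_gammaTerm_le b f)⟩
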